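/- Let $\mathcal M$ be a (smooth, finite-dimensional, Hausdorff, boundaryless) Riemannian manifold with Levi-Civita connection $\nabla$, and let $R:T\mathcal M\to\mathcal M$ be a retraction, i.e. a smooth map with $R(0_x)=x$ and $d(R|_{T_x\mathcal M})_{0_x}=\mathrm{Id}_{T_x\mathcal M}$ for all $x\in\mathcal M$. Let $p\ge 0$ be an integer, let $f\in C^{p+1}(\mathcal M)$, let $x\in\mathcal M$, write $R_x=R|_{T_x\mathcal M}$, let $v,\tilde v\in T_x\mathcal M$, and put $\gamma(t)=R(v+t\tilde v)$ for $t\in\mathbb R$. Then $$ \Bigl|D^{p+1}(f\circ R_x)(v)\bigl[\tilde v^{\otimes(p+1)}\bigr]\Bigr| \;\le\;(p+1)!\cdot\max_{1\le k\le p+1}\frac{\|\nabla^k f(R(v))\|}{k!}\cdot \sum_{\ell}\ \prod_{i=1}^{k(\ell)}\frac{\bigl\|D_t^{\ell_i-1}\gamma'(0)\bigr\|}{\ell_i!}, $$ where the sum runs over all compositions $\ell=(\ell_1,\dots,\ell_{k(\ell)})$ of $p+1$, that is, over all finite sequences of positive integers of any length $k(\ell)\in\{1,\dots,p+1\}$ with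 $\ell_1+\dots+\ell_{k(\ell)}=p+1$. Here $D^{p+1}$ is the classical derivative on the vector space $T_x\mathcal M$, $\nabla^k f$ is the $k$-th covariant derivative of $f$, $\|T\|=\sup\{T(v_1,\dots,v_k):\|v_i\|=1\}$ is the operator norm of a $k$-linear form, and $D_t$ is the covariant derivative of vector fields along $\gamma$. -/

import Mathlib

open Bundle
open scoped Manifold ContDiff Nat

noncomputable section

namespace RiemannianPullback

set_option linter.unusedSectionVars false
set_option linter.unusedSimpArgs false

section LeviCivita

variable {E : Type*} [NormedAddCommGroup E] [NormedSpace ℝ E] [FiniteDimensional ℝ E]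
  {M : Type*} [TopologicalSpace M] [ChartedSpace E M] [IsManifold 𝓘(ℝ, E) ∞ M]
  [RiemannianBundle (fun x : M => TangentSpace 𝓘(ℝ, E) x)]
  [IsContMDiffRiemannianBundle 𝓘(ℝ, E) ∞ E (fun x : M => TangentSpace 𝓘(ℝ, E) x)]

/-- The derivative of the function `⟨X, Y⟩` at `x` along the tangent vector `u`. -/
def dInner (X Y : Π x : M, TangentSpace 𝓘(ℝ, E) x) (x : M) (u : TangentSpace 𝓘(ℝ, E) x) : ℝ :=
  mvfderiv 𝓘(ℝ, E) (fun y => inner ℝ (X y) (Y y)) x u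

/-- The right-hand side of the Koszul formula for `2 ⟨∇_X Y, Z⟩`. -/
def koszul (X Y Z : Π x : M, TangentSpace 𝓘(ℝ, E) x) (x : M) : ℝ :=
  dInner Y Z x (X x) + dInner Z X x (Y x) - dInner X Y x (Z x)
    + inner ℝ (VectorField.mlieBracket 𝓘(ℝ, E) X Y x) (Z x)
    - inner ℝ (VectorField.mlieBracket 𝓘(ℝ, E) Y Z x) (X x)
    + inner ℝ (VectorField.mlieBracket 𝓘(ℝ, E) Z X x) (Y x)

variable {X X' Y Y' Z Z' : Π x : M, TangentSpace 𝓘(ℝ, E) x} {x : M}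

lemma dInner_comm (u : TangentSpace 𝓘(ℝ, E) x) : dInner X Y x u = dInner Y X x u := by
  simp only [dInner, real_inner_comm]

lemma mdifferentiableAt_inner (hX : MDiffAt (T% X) x) (hY : MDiffAt (T% Y) x) :
    MDiffAt (fun y => (inner ℝ (X y) (Y y) : ℝ)) x :=
  MDifferentiableAt.inner_bundle (F := E) (E := fun x : M => TangentSpace 𝓘(ℝ, E) x) hX hY

lemma dInner_add (hX : MDiffAt (T% X) x) (hX' : MDiffAt (T% X') x) (hY : MDiffAt (T% Y) x)
    (u : TangentSpace 𝓘(ℝ, E) x) :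
    dInner (X + X') Y x u = dInner X Y x u + dInner X' Y x u := by
  simp [dInner, inner_add_left, mvfderiv_fun_add (mdifferentiableAt_inner hX hY) (mdifferentiableAt_inner hX' hY)]

lemma dInner_smul {f : M → ℝ} (hf : MDiffAt f x) (hX : MDiffAt (T% X) x) (hY : MDiffAt (T% Y) x)
    (u : TangentSpace 𝓘(ℝ, E) x) :
    dInner (f • X) Y x u
      = f x * dInner X Y x u + mvfderiv 𝓘(ℝ, E) f x u * inner ℝ (X x) (Y x) := by
  simp [dInner, inner_smul_left, mvfderiv_fun_mul hf (mdifferentiableAt_inner hX hY)]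
  ring

lemma koszul_add_left (hX : MDiffAt (T% X) x) (hX' : MDiffAt (T% X') x) (hY : MDiffAt (T% Y) x)
    (hZ : MDiffAt (T% Z) x) : koszul (X + X') Y Z x = koszul X Y Z x + koszul X' Y Z x := by
  simp only [koszul, dInner_comm (X := Z), dInner_add hX hX' hZ, dInner_add hX hX' hY,
    VectorField.mlieBracket_add_left hX hX', VectorField.mlieBracket_add_right hX hX',
    Pi.add_apply, map_add, inner_add_left, inner_add_right]
  simp only [dInner, map_add]
  ring

lemma koszul_add_middle (hX : MDiffAt (T% X) x) (hY : MDiffAt (T% Y) x) (hY' : MDiffAt (T% Y') x)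
    (hZ : MDiffAt (T% Z) x) : koszul X (Y + Y') Z x = koszul X Y Z x + koszul X Y' Z x := by
  simp only [koszul, dInner_comm (X := X), dInner_add hY hY' hZ, dInner_add hY hY' hX,
    VectorField.mlieBracket_add_left hY hY', VectorField.mlieBracket_add_right hY hY',
    Pi.add_apply, inner_add_left, inner_add_right]
  simp only [dInner, map_add]
  ring

lemma koszul_add_right (hX : MDiffAt (T% X) x) (hY : MDiffAt (T% Y) x) (hZ : MDiffAt (T% Z) x)
    (hZ' : MDiffAt (T% Z') x) : koszul X Y (Z + Z') x = koszul X Y Z x + koszul X Y Z' x := by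
  simp only [koszul, dInner_comm (X := Y), dInner_add hZ hZ' hX, dInner_add hZ hZ' hY,
    VectorField.mlieBracket_add_left hZ hZ', VectorField.mlieBracket_add_right hZ hZ',
    Pi.add_apply, inner_add_left, inner_add_right]
  simp only [dInner, map_add]
  ring

lemma koszul_smul_left {f : M → ℝ} (hf : MDiffAt f x) (hX : MDiffAt (T% X) x)
    (hY : MDiffAt (T% Y) x) (hZ : MDiffAt (T% Z) x) :
    koszul (f • X) Y Z x = f x * koszul X Y Z x := by
  simp only [koszul, dInner_comm (X := Z), dInner_smul hf hX hZ, dInner_smul hf hX hY,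
    VectorField.mlieBracket_smul_left hf hX, VectorField.mlieBracket_smul_right hf hX,
    Pi.smul_apply', inner_add_left, inner_smul_left, inner_smul_right]
  simp only [dInner, map_smul, real_inner_comm (X x)]
  simp
  ring

lemma koszul_smul_middle {f : M → ℝ} (hf : MDiffAt f x) (hX : MDiffAt (T% X) x)
    (hY : MDiffAt (T% Y) x) (hZ : MDiffAt (T% Z) x) :
    koszul X (f • Y) Z x
      = f x * koszul X Y Z x + 2 * (mvfderiv 𝓘(ℝ, E) f x (X x) * inner ℝ (Y x) (Z x)) := by
  simp only [koszul, dInner_comm (X := X), dInner_smul hf hY hZ, dInner_smul hf hY hX,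
    VectorField.mlieBracket_smul_left hf hY, VectorField.mlieBracket_smul_right hf hY,
    Pi.smul_apply', inner_add_left, inner_smul_left, inner_smul_right]
  simp only [dInner, map_smul, real_inner_comm (X x)]
  simp
  ring

lemma koszul_smul_right {f : M → ℝ} (hf : MDiffAt f x) (hX : MDiffAt (T% X) x)
    (hY : MDiffAt (T% Y) x) (hZ : MDiffAt (T% Z) x) :
    koszul X Y (f • Z) x = f x * koszul X Y Z x := by
  simp only [koszul, dInner_comm (X := Y), dInner_smul hf hZ hX, dInner_smul hf hZ hY,
    VectorField.mlieBracket_smul_left hf hZ, VectorField.mlieBracket_smul_right hf hZ,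
    Pi.smul_apply', inner_add_left, inner_smul_left, inner_smul_right]
  simp only [dInner, map_smul, real_inner_comm (X x), real_inner_comm (Y x)]
  simp
  ring

lemma exists_koszul_riesz (hY : MDiffAt (T% Y) x) :
    ∃ A : TangentSpace 𝓘(ℝ, E) x →L[ℝ] TangentSpace 𝓘(ℝ, E) x,
      ∀ X Z : Π x : M, TangentSpace 𝓘(ℝ, E) x, MDiffAt (T% X) x → MDiffAt (T% Z) x →
        2 * inner ℝ (A (X x)) (Z x) = koszul X Y Z x := by
  have h1 : ∀ Z : Π x : M, TangentSpace 𝓘(ℝ, E) x, MDiffAt (T% Z) x →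
      TensorialAt 𝓘(ℝ, E) E (fun X => koszul X Y Z x) x := fun Z hZ =>
    { smul := fun hf hX => koszul_smul_left hf hX hY hZ
      add := fun hX hX' => koszul_add_left hX hX' hY hZ }
  have h2 : ∀ X : Π x : M, TangentSpace 𝓘(ℝ, E) x, MDiffAt (T% X) x →
      TensorialAt 𝓘(ℝ, E) E (fun Z => koszul X Y Z x) x := fun X hX =>
    { smul := fun hf hZ => koszul_smul_right hf hX hY hZ
      add := fun hZ hZ' => koszul_add_right hX hY hZ hZ' }
  let B := TensorialAt.mkHom₂ (fun X Z => koszul X Y Z x) x h1 h2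
  have : FiniteDimensional ℝ (TangentSpace 𝓘(ℝ, E) x) := inferInstanceAs (FiniteDimensional ℝ E)
  have : CompleteSpace (TangentSpace 𝓘(ℝ, E) x) := FiniteDimensional.complete ℝ _
  let D := InnerProductSpace.toDual ℝ (TangentSpace 𝓘(ℝ, E) x)
  let L : TangentSpace 𝓘(ℝ, E) x →ₗ[ℝ] TangentSpace 𝓘(ℝ, E) x :=
    { toFun := fun u => (1 / 2 : ℝ) • D.symm (B u)
      map_add' := fun u v => by simp
      map_smul' := fun c u => by simp [smul_smul, mul_comm] }
  refine ⟨L.toContinuousLinearMap, fun X Z hX hZ => ?_⟩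
  have : inner ℝ (D.symm (B (X x))) (Z x) = B (X x) (Z x) :=
    InnerProductSpace.toDual_symm_apply
  change 2 * inner ℝ ((1 / 2 : ℝ) • D.symm (B (X x))) (Z x) = _
  rw [real_inner_smul_left, this, TensorialAt.mkHom₂_apply h1 h2 hX hZ]
  ring

/-- A connection on `TM` is Levi-Civita if it is compatible with the metric and torsion free. -/
def IsLeviCivita
    (cov : CovariantDerivative 𝓘(ℝ, E) E (fun x : M => TangentSpace 𝓘(ℝ, E) x)) : Prop :=
  CovariantDerivative.IsMetricCompatible (V := fun x : M => TangentSpace 𝓘(ℝ, E) x) cov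
    ∧ cov.torsion = 0

/-- **Fundamental theorem of Riemannian geometry**, existence part. -/
theorem exists_leviCivita (E M : Type*) [NormedAddCommGroup E] [NormedSpace ℝ E]
    [FiniteDimensional ℝ E] [TopologicalSpace M] [ChartedSpace E M] [IsManifold 𝓘(ℝ, E) ∞ M]
    [RiemannianBundle (fun x : M => TangentSpace 𝓘(ℝ, E) x)]
    [IsContMDiffRiemannianBundle 𝓘(ℝ, E) ∞ E (fun x : M => TangentSpace 𝓘(ℝ, E) x)] :
    ∃ cov : CovariantDerivative 𝓘(ℝ, E) E (fun x : M => TangentSpace 𝓘(ℝ, E) x),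
      IsLeviCivita cov := by
  classical
  let A : (Π x : M, TangentSpace 𝓘(ℝ, E) x) →
      (Π x : M, TangentSpace 𝓘(ℝ, E) x →L[ℝ] TangentSpace 𝓘(ℝ, E) x) := fun Y x =>
    if hY : MDiffAt (T% Y) x then Classical.choose (exists_koszul_riesz hY) else 0
  have hA : ∀ {X Y Z : Π x : M, TangentSpace 𝓘(ℝ, E) x} {x : M}, MDiffAt (T% X) x →
      MDiffAt (T% Y) x → MDiffAt (T% Z) x →
      2 * inner ℝ (A Y x (X x)) (Z x) = koszul X Y Z x := by
    intro X Y Z x hX hY hZ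
    simp only [A, dif_pos hY]
    exact Classical.choose_spec (exists_koszul_riesz hY) X Z hX hZ
  have hext : ∀ {x : M} {u u' : TangentSpace 𝓘(ℝ, E) x},
      (∀ Z : Π x : M, TangentSpace 𝓘(ℝ, E) x, MDiffAt (T% Z) x →
        2 * inner ℝ u (Z x) = 2 * inner ℝ u' (Z x)) → u = u' := by
    intro x u u' h
    refine ext_inner_right ℝ fun w => ?_
    have := h (FiberBundle.extend E w) (FiberBundle.mdifferentiableAt_extend ..)
    simpa using this
  let cov : CovariantDerivative 𝓘(ℝ, E) E (fun x : M => TangentSpace 𝓘(ℝ, E) x) :=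
    { toFun := A
      isCovariantDerivativeOnUniv :=
        { add := by
            intro Y Y' x hY hY' _
            ext u
            refine hext fun Z hZ => ?_
            have hX := FiberBundle.mdifferentiableAt_extend 𝓘(ℝ, E) E u
            have hX' : FiberBundle.extend E u x = u := FiberBundle.extend_apply_self E u
            have e1 := hA hX (mdifferentiableAt_add_section hY hY') hZ
            have e2 := hA hX hY hZ
            have e3 := hA hX hY' hZ
            rw [hX'] at e1 e2 e3
            rw [add_apply, inner_add_left, mul_add, e2, e3,
              ← koszul_add_middle hX hY hY' hZ]
            exact e1
          leibniz := by
            intro Y g x hY hg _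
            ext u
            refine hext fun Z hZ => ?_
            have hX := FiberBundle.mdifferentiableAt_extend 𝓘(ℝ, E) E u
            have hX' : FiberBundle.extend E u x = u := FiberBundle.extend_apply_self E u
            have e1 := hA hX (hg.smul_section hY) hZ
            have e2 := hA hX hY hZ
            have e3 := koszul_smul_middle hg hX hY hZ
            rw [hX'] at e1 e2 e3
            rw [add_apply, inner_add_left, mul_add]
            simp only [smul_apply, ContinuousLinearMap.smulRight_apply,
              real_inner_smul_left]
            linear_combination e1 + e3 - g x * e2 } }
  refine ⟨cov, ?_, ?_⟩
  · rw [CovariantDerivative.isMetricCompatible_iff]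
    intro x X Y Z hX hY hZ
    have e1 := hA hX hY hZ
    have e2 := hA hX hZ hY
    change dInner Y Z x (X x) = inner ℝ (A Y x (X x)) (Z x) + inner ℝ (Y x) (A Z x (X x))
    rw [real_inner_comm (A Z x (X x)) (Y x)]
    simp only [koszul] at e1 e2
    rw [dInner_comm (X := Z) (Y := Y), VectorField.mlieBracket_swap_apply (V := Z) (W := Y),
      VectorField.mlieBracket_swap_apply (V := Y) (W := X),
      VectorField.mlieBracket_swap_apply (V := X) (W := Z),
      dInner_comm (X := Y) (Y := X), dInner_comm (X := X) (Y := Z)] at e2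
    simp only [inner_neg_left] at e2
    linarith
  · rw [CovariantDerivative.torsion_eq_zero_iff]
    intro X Y x hX hY
    refine hext fun Z hZ => ?_
    have e1 := hA hX hY hZ
    have e2 := hA hY hX hZ
    change 2 * inner ℝ (A Y x (X x) - A X x (Y x)) (Z x) = _
    rw [inner_sub_left, mul_sub, e1, e2]
    simp only [koszul]
    rw [dInner_comm (X := X) (Y := Z), dInner_comm (X := Y) (Y := X),
      dInner_comm (X := Z) (Y := Y), VectorField.mlieBracket_swap_apply (V := Y) (W := X),
      VectorField.mlieBracket_swap_apply (V := X) (W := Z),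
      VectorField.mlieBracket_swap_apply (V := Z) (W := Y)]
    simp only [inner_neg_left]
    ring

/-- The Levi-Civita connection of `M`: the covariant derivative on `TM` that is compatible with the
metric and torsion free. These two properties determine its value on every vector field that is
differentiable at the point under consideration. As in Mathlib, `leviCivita E M Y x u` is
`(∇_u Y)(x)`. -/
def leviCivita (E M : Type*) [NormedAddCommGroup E] [NormedSpace ℝ E]
    [FiniteDimensional ℝ E] [TopologicalSpace M] [ChartedSpace E M] [IsManifold 𝓘(ℝ, E) ∞ M]
    [RiemannianBundle (fun x : M => TangentSpace 𝓘(ℝ, E) x)]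
    [IsContMDiffRiemannianBundle 𝓘(ℝ, E) ∞ E (fun x : M => TangentSpace 𝓘(ℝ, E) x)] :
    CovariantDerivative 𝓘(ℝ, E) E (fun x : M => TangentSpace 𝓘(ℝ, E) x) :=
  Classical.choose (exists_leviCivita E M)

theorem isLeviCivita_leviCivita : IsLeviCivita (leviCivita E M) :=
  Classical.choose_spec (exists_leviCivita E M)

end LeviCivita

section CovariantCalculus

variable {E : Type*} [NormedAddCommGroup E] [NormedSpace ℝ E] [FiniteDimensional ℝ E]
  {M : Type*} [TopologicalSpace M] [ChartedSpace E M] [IsManifold 𝓘(ℝ, E) ∞ M]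
  [RiemannianBundle (fun x : M => TangentSpace 𝓘(ℝ, E) x)]
  [IsContMDiffRiemannianBundle 𝓘(ℝ, E) ∞ E (fun x : M => TangentSpace 𝓘(ℝ, E) x)]

/-- The covariant derivative of a covariant `k`-tensor field `T`:
`(∇T)(U₀, U₁, …, U_k) = U₀ (T(U₁, …, U_k)) - ∑ᵢ T(U₁, …, ∇_{U₀} Uᵢ, …, U_k)`,
where the tangent vectors `uᵢ` at `x` are extended to smooth vector fields `Uᵢ` near `x`
(`FiberBundle.extend` takes the extension with constant coordinates in the preferred chart
at `x`; the result does not depend on the extension). -/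
def tensorCovDeriv {k : ℕ} (T : Π x : M, (Fin k → TangentSpace 𝓘(ℝ, E) x) → ℝ) :
    Π x : M, (Fin (k + 1) → TangentSpace 𝓘(ℝ, E) x) → ℝ := fun x u =>
  mvfderiv 𝓘(ℝ, E) (fun y => T y (fun i => FiberBundle.extend E (u i.succ) y)) x (u 0)
    - ∑ i : Fin k, T x (Function.update (fun j => u j.succ) i
        (leviCivita E M (FiberBundle.extend E (u i.succ)) x (u 0)))

variable (E)

/-- The `k`-th covariant derivative `∇^k f` of a function, a field of covariant `k`-tensors. -/
def iteratedCovDeriv (f : M → ℝ) : (k : ℕ) → Π x : M, (Fin k → TangentSpace 𝓘(ℝ, E) x) → ℝ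
  | 0 => fun x _ => f x
  | k + 1 => tensorCovDeriv (iteratedCovDeriv f k)

/-- The operator norm `sup {T(v₁, …, v_k) : ‖vᵢ‖ = 1}` of a `k`-linear form. -/
def tensorNorm {V : Type*} [NormedAddCommGroup V] {k : ℕ} (T : (Fin k → V) → ℝ) : ℝ :=
  sSup {r : ℝ | ∃ v : Fin k → V, (∀ i, ‖v i‖ = 1) ∧ T v = r}

/-- The velocity field `γ'` of a curve. -/
def velocity (γ : ℝ → M) : Π t : ℝ, TangentSpace 𝓘(ℝ, E) (γ t) := fun t =>
  mfderiv 𝓘(ℝ, ℝ) 𝓘(ℝ, E) γ t (1 : ℝ)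

/-- The covariant derivative `D_t V` of a vector field `V` along a curve `γ`. Writing
`V = ∑ⱼ Vʲ ∂ⱼ` in the preferred chart at `γ t`, this is
`(D_t V)(t) = ∑ⱼ (Vʲ)'(t) ∂ⱼ + ∑ⱼ Vʲ(t) ∇_{γ'(t)} ∂ⱼ`; the second sum is `∇_{γ'(t)}` of the field
which has the constant coordinates `Vʲ(t)` in that chart. -/
def covDerivAlong (γ : ℝ → M) (V : Π t : ℝ, TangentSpace 𝓘(ℝ, E) (γ t)) :
    Π t : ℝ, TangentSpace 𝓘(ℝ, E) (γ t) := fun t =>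
  (trivializationAt E (TangentSpace 𝓘(ℝ, E)) (γ t)).symm (γ t)
      (deriv (fun s : ℝ =>
        (trivializationAt E (TangentSpace 𝓘(ℝ, E)) (γ t) ⟨γ s, V s⟩).2) t)
    + leviCivita E M (FiberBundle.extend E (V t)) (γ t) (velocity E γ t)

variable {E}

/-- A retraction: a smooth map `R : TM → M` with `R(0_x) = x` and `d(R|_{T_xM})_{0_x} = Id`. -/
structure IsRetraction (R : TangentBundle 𝓘(ℝ, E) M → M) : Prop where
  contMDiff : ContMDiff 𝓘(ℝ, E).tangent 𝓘(ℝ, E) ∞ R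
  map_zero : ∀ x : M, R ⟨x, 0⟩ = x
  mfderiv_zero : ∀ x : M, ∀ u : TangentSpace 𝓘(ℝ, E) x,
    mfderiv 𝓘(ℝ, TangentSpace 𝓘(ℝ, E) x) 𝓘(ℝ, E)
      (fun w : TangentSpace 𝓘(ℝ, E) x => R ⟨x, w⟩) 0 u = u

end CovariantCalculus

end RiemannianPullback

end

open RiemannianPullback

noncomputable section

namespace RiemannianPullback

open Bundle Filter Topology
open scoped Manifold ContDiff Nat

set_option linter.unusedSectionVars false

/-! ### Derivatives of vector-valued functions on manifolds. -/

section ManifoldCalculus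

/-! Restricting to the line `v + t • w` turns the pullback derivative into the ordinary derivative
`(f ∘ γ)^(p+1)(0)`. The product rule for a tensor field along a curve
(`IsTensorField.mvfderiv_along`) says that differentiating `∇^k f (D_t^{j₁-1} γ', …)` either
produces `∇^{k+1} f` with `γ'` in a new first slot, or applies `D_t` to one of the arguments. This
is the recursion that builds set partitions of `n + 1` points from those of `n`: the new point is a
block of its own or joins an old block. Hence the covariant Faà di Bruno formula
`iteratedDeriv_comp_curve`, a sum over ordered set partitions.

A term with `k` blocks is at most `‖∇^k f‖ ∏ ‖D_t^{j_i-1} γ'‖`. Writing `‖∇^k f‖ = k! · (‖∇^k f‖ /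
k!)` and pulling out the maximum leaves the set partitions weighted by `k!`, which
`sum_orderedFinpartition_eq_sum_composition` converts exactly into the sum over compositions.

The analytic work is regularity: the formula can be iterated only if every `D_t^j γ'` is smooth and
every `∇^k f` has the expected class. Both rest on `contMDiffAt_leviCivita`, obtained from the
Koszul formula and inversion of the Gram operator. -/

lemma _root_.ContMDiffAt.eventually_mdifferentiableAt {𝕜 : Type*} [NontriviallyNormedField 𝕜]
    {E : Type*} [NormedAddCommGroup E] [NormedSpace 𝕜 E] {H : Type*} [TopologicalSpace H]
    {I : ModelWithCorners 𝕜 E H} {M : Type*} [TopologicalSpace M] [ChartedSpace H M]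
    [IsManifold I 1 M]
    {E' : Type*} [NormedAddCommGroup E'] [NormedSpace 𝕜 E'] {H' : Type*} [TopologicalSpace H']
    {I' : ModelWithCorners 𝕜 E' H'} {N : Type*} [TopologicalSpace N] [ChartedSpace H' N]
    [IsManifold I' 1 N]
    {h : M → N} {x : M} {n : ℕ∞ω} (hh : ContMDiffAt I I' n h x) (hn : 1 ≤ n) :
    ∀ᶠ y in 𝓝 x, MDifferentiableAt I I' h y := by
  filter_upwards [(contMDiffAt_iff_contMDiffAt_nhds (by simp)).1 (hh.of_le hn)] with y hy
  exact hy.mdifferentiableAt (by simp)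

variable {E : Type*} [NormedAddCommGroup E] [NormedSpace ℝ E]
  {M : Type*} [TopologicalSpace M] [ChartedSpace E M] [IsManifold 𝓘(ℝ, E) ∞ M]

lemma _root_.ContMDiffAt.mvfderiv_apply {F : Type*} [NormedAddCommGroup F] [NormedSpace ℝ F]
    {m n : ℕ∞ω} {h : M → F} {X : Π y : M, TangentSpace 𝓘(ℝ, E) y} {x : M}
    (hh : ContMDiffAt 𝓘(ℝ, E) 𝓘(ℝ, F) n h x) (hX : CMDiffAt m (T% X) x) (hmn : m + 1 ≤ n) :
    ContMDiffAt 𝓘(ℝ, E) 𝓘(ℝ, F) m (fun y => mvfderiv 𝓘(ℝ, E) h y (X y)) x := by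
  have h1 := hh.mfderiv_const hmn
  have h2 : ContMDiffAt 𝓘(ℝ, E) 𝓘(ℝ, F) m h x := hh.of_le (le_self_add.trans hmn)
  have h3 := ContMDiffAt.clm_apply_of_inCoordinates (b₁ := id) (b₂ := h)
    (ϕ := fun y => mfderiv 𝓘(ℝ, E) 𝓘(ℝ, F) h y) (v := X) (F₁ := E) (F₂ := F)
    (E₁ := fun x : M => TangentSpace 𝓘(ℝ, E) x) (E₂ := fun x : F => TangentSpace 𝓘(ℝ, F) x)
    (IB₂ := 𝓘(ℝ, F)) h1 hX h2
  have h4 := (contMDiffAt_totalSpace.1 h3).2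
  simpa [mvfderiv, NormedSpace.fromTangentSpace, TangentBundle.trivializationAt_apply] using! h4

omit [IsManifold 𝓘(ℝ, E) ∞ M] in
lemma _root_.Filter.EventuallyEq.mvfderiv_eq {F : Type*} [NormedAddCommGroup F] [NormedSpace ℝ F]
    {g h : M → F} {x : M} (hgh : g =ᶠ[𝓝 x] h) : mvfderiv 𝓘(ℝ, E) g x = mvfderiv 𝓘(ℝ, E) h x := by
  have h1 : mfderiv 𝓘(ℝ, E) 𝓘(ℝ, F) g x = mfderiv 𝓘(ℝ, E) 𝓘(ℝ, F) h x := hgh.mfderiv_eq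
  exact ContinuousLinearMap.ext fun v => congrArg (fun L : E →L[ℝ] F => L v) h1

end ManifoldCalculus

/-! ### Coordinates and constant-coefficient fields in the preferred trivializations. -/

section Coordinates

variable {E : Type*} [NormedAddCommGroup E] [NormedSpace ℝ E]
  {M : Type*} [TopologicalSpace M] [ChartedSpace E M] [IsManifold 𝓘(ℝ, E) ∞ M]

variable (E) in
/-- The coordinates of tangent vectors at `y` in the preferred trivialization at `x`. -/
def coord (x y : M) : TangentSpace 𝓘(ℝ, E) y →L[ℝ] E :=
  (trivializationAt E (TangentSpace 𝓘(ℝ, E)) x).continuousLinearMapAt ℝ y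

/-- The vector field with constant coordinates in the preferred trivialization at `x`. -/
def frame (x y : M) : E →L[ℝ] TangentSpace 𝓘(ℝ, E) y :=
  (trivializationAt E (TangentSpace 𝓘(ℝ, E)) x).symmL ℝ y

variable (E) in
lemma mem_baseSet_self (x : M) :
    x ∈ (trivializationAt E (TangentSpace 𝓘(ℝ, E)) x).baseSet :=
  FiberBundle.mem_baseSet_trivializationAt E (TangentSpace 𝓘(ℝ, E)) x

variable (E) in
lemma eventually_mem_baseSet (x : M) :
    ∀ᶠ y in 𝓝 x, y ∈ (trivializationAt E (TangentSpace 𝓘(ℝ, E)) x).baseSet :=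
  (Trivialization.open_baseSet _).mem_nhds (mem_baseSet_self E x)

lemma coord_frame {x y : M} (hy : y ∈ (trivializationAt E (TangentSpace 𝓘(ℝ, E)) x).baseSet)
    (ξ : E) : coord E x y (frame x y ξ) = ξ :=
  Trivialization.continuousLinearMapAt_symmL _ hy ξ

lemma frame_coord {x y : M} (hy : y ∈ (trivializationAt E (TangentSpace 𝓘(ℝ, E)) x).baseSet)
    (u : TangentSpace 𝓘(ℝ, E) y) : frame x y (coord E x y u) = u :=
  Trivialization.symmL_continuousLinearMapAt _ hy u

@[simp] lemma coord_frame_self (x : M) (ξ : E) : coord E x x (frame x x ξ) = ξ :=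
  coord_frame (mem_baseSet_self E x) ξ

@[simp] lemma frame_coord_self (x : M) (u : TangentSpace 𝓘(ℝ, E) x) :
    frame x x (coord E x x u) = u :=
  frame_coord (mem_baseSet_self E x) u

lemma trivializationAt_eq_coord {x y : M}
    (hy : y ∈ (trivializationAt E (TangentSpace 𝓘(ℝ, E)) x).baseSet)
    (u : TangentSpace 𝓘(ℝ, E) y) :
    (trivializationAt E (TangentSpace 𝓘(ℝ, E)) x ⟨y, u⟩).2 = coord E x y u :=
  (Trivialization.continuousLinearMapAt_apply_of_mem ℝ _ hy u).symm

lemma symm_eq_frame {x y : M}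
    (hy : y ∈ (trivializationAt E (TangentSpace 𝓘(ℝ, E)) x).baseSet) (ξ : E) :
    (trivializationAt E (TangentSpace 𝓘(ℝ, E)) x).symm y ξ = frame x y ξ :=
  (Trivialization.symmL_apply _ hy ξ).symm

/-- Replaces the extension in the definitions of `∇` and `D_t` by a field that is visibly linear in
its coordinates. -/
lemma extend_eq_frame {x y : M}
    (hy : y ∈ (trivializationAt E (TangentSpace 𝓘(ℝ, E)) x).baseSet)
    (u : TangentSpace 𝓘(ℝ, E) x) : FiberBundle.extend E u y = frame x y (coord E x x u) := by
  rw [← symm_eq_frame hy, ← trivializationAt_eq_coord (mem_baseSet_self E x)]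
  rfl

lemma contMDiffAt_frame {x y : M}
    (hy : y ∈ (trivializationAt E (TangentSpace 𝓘(ℝ, E)) x).baseSet) (ξ : E) :
    CMDiffAt ∞ (T% (fun z : M => frame x z ξ)) y := by
  rw [Trivialization.contMDiffAt_section_iff _ hy]
  refine (contMDiffAt_const (c := ξ)).congr_of_eventuallyEq ?_
  filter_upwards [(Trivialization.open_baseSet _).mem_nhds hy] with z hz
  rw [trivializationAt_eq_coord hz, coord_frame hz]

section Along

variable {E' : Type*} [NormedAddCommGroup E'] [NormedSpace ℝ E']
  {N : Type*} [TopologicalSpace N] [ChartedSpace E' N] {c : N → M}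
  {W : Π r : N, TangentSpace 𝓘(ℝ, E) (c r)} {s : N}

lemma eventually_comp_mem_baseSet (hc : ContinuousAt c s) :
    ∀ᶠ r in 𝓝 s, c r ∈ (trivializationAt E (TangentSpace 𝓘(ℝ, E)) (c s)).baseSet :=
  hc.eventually (eventually_mem_baseSet E (c s))

lemma contMDiffAt_along_iff {n : ℕ∞ω} :
    ContMDiffAt 𝓘(ℝ, E') 𝓘(ℝ, E).tangent n (fun r => (⟨c r, W r⟩ : TangentBundle 𝓘(ℝ, E) M)) s ↔
      ContMDiffAt 𝓘(ℝ, E') 𝓘(ℝ, E) n c s ∧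
      ContMDiffAt 𝓘(ℝ, E') 𝓘(ℝ, E) n (fun r => coord E (c s) (c r) (W r)) s := by
  refine contMDiffAt_totalSpace.trans (and_congr_right fun hc => ?_)
  refine EventuallyEq.contMDiffAt_iff ?_
  filter_upwards [eventually_comp_mem_baseSet (E := E) hc.continuousAt] with r hr
  exact trivializationAt_eq_coord hr (W r)

lemma mdifferentiableAt_along_iff :
    MDifferentiableAt 𝓘(ℝ, E') 𝓘(ℝ, E).tangent (fun r => (⟨c r, W r⟩ : TangentBundle 𝓘(ℝ, E) M)) s ↔
      MDifferentiableAt 𝓘(ℝ, E') 𝓘(ℝ, E) c s ∧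
      MDifferentiableAt 𝓘(ℝ, E') 𝓘(ℝ, E) (fun r => coord E (c s) (c r) (W r)) s := by
  refine (mdifferentiableAt_totalSpace 𝓘(ℝ, E) _).trans (and_congr_right fun hc => ?_)
  refine EventuallyEq.mdifferentiableAt_iff ?_
  filter_upwards [eventually_comp_mem_baseSet (E := E) hc.continuousAt] with r hr
  exact trivializationAt_eq_coord hr (W r)

end Along

end Coordinates

/-! ### Smoothness of the Levi-Civita connection. -/

section LeviCivitaRegularity

variable {E : Type*} [NormedAddCommGroup E] [NormedSpace ℝ E] [FiniteDimensional ℝ E]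
  {M : Type*} [TopologicalSpace M] [ChartedSpace E M] [IsManifold 𝓘(ℝ, E) ∞ M]
  [RiemannianBundle (fun x : M => TangentSpace 𝓘(ℝ, E) x)]
  [IsContMDiffRiemannianBundle 𝓘(ℝ, E) ∞ E (fun x : M => TangentSpace 𝓘(ℝ, E) x)]

variable {X Y Z : Π x : M, TangentSpace 𝓘(ℝ, E) x} {x : M}

lemma contMDiffAt_inner (hX : CMDiffAt ∞ (T% X) x) (hY : CMDiffAt ∞ (T% Y) x) :
    ContMDiffAt 𝓘(ℝ, E) 𝓘(ℝ, ℝ) ∞ (fun y => (inner ℝ (X y) (Y y) : ℝ)) x :=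
  ContMDiffAt.inner_bundle (F := E) (E := fun x : M => TangentSpace 𝓘(ℝ, E) x) hX hY

lemma contMDiffAt_dInner (hX : CMDiffAt ∞ (T% X) x) (hY : CMDiffAt ∞ (T% Y) x)
    (hZ : CMDiffAt ∞ (T% Z) x) :
    ContMDiffAt 𝓘(ℝ, E) 𝓘(ℝ, ℝ) ∞ (fun y => dInner X Y y (Z y)) x :=
  (contMDiffAt_inner hX hY).mvfderiv_apply hZ (by simp)

lemma contMDiffAt_inner_mlieBracket (hX : CMDiffAt ∞ (T% X) x) (hY : CMDiffAt ∞ (T% Y) x)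
    (hZ : CMDiffAt ∞ (T% Z) x) :
    ContMDiffAt 𝓘(ℝ, E) 𝓘(ℝ, ℝ) ∞
      (fun y => (inner ℝ (VectorField.mlieBracket 𝓘(ℝ, E) X Y y) (Z y) : ℝ)) x := by
  have : CompleteSpace E := FiniteDimensional.complete ℝ E
  have : IsManifold 𝓘(ℝ, E) (minSmoothness ℝ 2) M := by
    rw [minSmoothness_of_isRCLikeNormedField]; infer_instance
  have : IsManifold 𝓘(ℝ, E) (((⊤ : ℕ∞) : ℕ∞ω) + 1) M := inferInstanceAs (IsManifold 𝓘(ℝ, E) ∞ M)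
  have : CMDiffAt ∞ (T% (VectorField.mlieBracket 𝓘(ℝ, E) X Y)) x :=
    ContMDiffAt.mlieBracket_vectorField (m := ⊤) (n := ⊤) hX hY (by simp)
  exact contMDiffAt_inner this hZ

lemma contMDiffAt_koszul (hX : CMDiffAt ∞ (T% X) x) (hY : CMDiffAt ∞ (T% Y) x)
    (hZ : CMDiffAt ∞ (T% Z) x) : ContMDiffAt 𝓘(ℝ, E) 𝓘(ℝ, ℝ) ∞ (koszul X Y Z) x :=
  (((((contMDiffAt_dInner hY hZ hX).add (contMDiffAt_dInner hZ hX hY)).sub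
    (contMDiffAt_dInner hX hY hZ)).add (contMDiffAt_inner_mlieBracket hX hY hZ)).sub
    (contMDiffAt_inner_mlieBracket hY hZ hX)).add (contMDiffAt_inner_mlieBracket hZ hX hY)

/-- The connection was obtained by choice, so only metric compatibility and vanishing torsion are
available; the classical cyclic sum recovers the Koszul formula from them. -/
lemma two_mul_inner_leviCivita (hX : MDiffAt (T% X) x) (hY : MDiffAt (T% Y) x)
    (hZ : MDiffAt (T% Z) x) :
    2 * inner ℝ (leviCivita E M Y x (X x)) (Z x) = koszul X Y Z x := by
  have : CompleteSpace E := FiniteDimensional.complete ℝ E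
  obtain ⟨hm, ht⟩ := isLeviCivita_leviCivita (E := E) (M := M)
  rw [CovariantDerivative.torsion_eq_zero_iff] at ht
  have m1 := hm.mvfderiv_inner_eq X hY hZ
  have m2 := hm.mvfderiv_inner_eq Y hZ hX
  have m3 := hm.mvfderiv_inner_eq Z hX hY
  simp only [koszul, dInner, ← ht hX hY, ← ht hY hZ, ← ht hZ hX, inner_sub_left, m1, m2, m3]
  simp only [real_inner_comm (Y x), real_inner_comm (X x), real_inner_comm (Z x)]
  ring

/-- The Gram operator of the metric in the preferred trivialization at `x`. -/
def gramOp (x y : M) : E →L[ℝ] E :=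
  ∑ i, ∑ j, (inner ℝ (frame x y (Module.finBasis ℝ E j)) (frame x y (Module.finBasis ℝ E i)) : ℝ) •
    ((Module.finBasis ℝ E).coord j).toContinuousLinearMap.smulRight (Module.finBasis ℝ E i)

/-- The defining double sum shows smoothness in `y`; this form shows that the operator sends the
coordinates of a vector to its list of inner products with the frame. -/
lemma gramOp_apply (x y : M) (ξ : E) : gramOp x y ξ =
    ∑ i, (inner ℝ (frame x y ξ) (frame x y (Module.finBasis ℝ E i)) : ℝ) • Module.finBasis ℝ E i := by
  have h (i) : (inner ℝ (frame x y ξ) (frame x y (Module.finBasis ℝ E i)) : ℝ) =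
      ∑ j, inner ℝ (frame x y (Module.finBasis ℝ E j)) (frame x y (Module.finBasis ℝ E i)) *
        (Module.finBasis ℝ E).repr ξ j := by
    conv_lhs => rw [← (Module.finBasis ℝ E).sum_repr ξ]
    simp only [map_sum, map_smul, sum_inner, real_inner_smul_left, mul_comm]
  simp only [h, Finset.sum_smul]
  simp [gramOp, smul_smul]

lemma contMDiffAt_gramOp (x : M) : ContMDiffAt 𝓘(ℝ, E) 𝓘(ℝ, E →L[ℝ] E) ∞ (gramOp (E := E) x) x := by
  unfold gramOp
  exact ContMDiffAt.sum fun i _ => ContMDiffAt.sum fun j _ =>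
    (contMDiffAt_inner (contMDiffAt_frame (mem_baseSet_self E x) _)
      (contMDiffAt_frame (mem_baseSet_self E x) _)).smul contMDiffAt_const

/-- A vector orthogonal to every frame vector is orthogonal to itself. -/
lemma gramOp_self_injective (x : M) : Function.Injective (gramOp (E := E) x x) := by
  rw [injective_iff_map_eq_zero]
  intro ξ hξ
  rw [gramOp_apply] at hξ
  have h1 := linearIndependent_iff'.1 (Module.finBasis ℝ E).linearIndependent Finset.univ _ hξ
  have h2 : inner ℝ (frame x x ξ) (frame x x ξ) = (0 : ℝ) := by
    conv_lhs => rw [← (Module.finBasis ℝ E).sum_repr ξ]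
    rw [map_sum, inner_sum]
    refine Finset.sum_eq_zero fun i hi => ?_
    rw [map_smul, inner_smul_right, ← map_sum, (Module.finBasis ℝ E).sum_repr ξ, h1 i hi, mul_zero]
  rw [← coord_frame_self x ξ, inner_self_eq_zero.1 h2, map_zero]

/-- The coordinates of `σ` are the inverse Gram operator applied to its inner products with the
frame, and inversion is smooth at an invertible operator. -/
lemma contMDiffAt_section_of_inner {σ : Π x : M, TangentSpace 𝓘(ℝ, E) x}
    (h : ∀ ξ : E, ContMDiffAt 𝓘(ℝ, E) 𝓘(ℝ, ℝ) ∞ (fun y => (inner ℝ (σ y) (frame x y ξ) : ℝ)) x) :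
    CMDiffAt ∞ (T% σ) x := by
  have : CompleteSpace E := FiniteDimensional.complete ℝ E
  let e : E ≃L[ℝ] E := (LinearEquiv.ofInjectiveEndo (gramOp (E := E) x x).toLinearMap
    (gramOp_self_injective x)).toContinuousLinearEquiv
  have he : (e : E →L[ℝ] E) = gramOp x x := by ext ξ; rfl
  have hinv : ContMDiffAt 𝓘(ℝ, E) 𝓘(ℝ, E →L[ℝ] E) ∞
      (fun y => ContinuousLinearMap.inverse (gramOp (E := E) x y)) x := by
    have h1 : ContDiffAt ℝ ∞ ContinuousLinearMap.inverse (gramOp (E := E) x x) := by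
      rw [← he]; exact contDiffAt_map_inverse e
    exact h1.contMDiffAt.comp x (contMDiffAt_gramOp x)
  have hv : ContMDiffAt 𝓘(ℝ, E) 𝓘(ℝ, E) ∞ (fun y => ∑ i,
      (inner ℝ (σ y) (frame x y (Module.finBasis ℝ E i)) : ℝ) • Module.finBasis ℝ E i) x :=
    ContMDiffAt.sum fun i _ => (h _).smul contMDiffAt_const
  rw [contMDiffAt_section]
  refine (hinv.clm_apply hv).congr_of_eventuallyEq ?_
  -- Invertibility is an open condition, so near `x` the total function `inverse` is a true inverse.
  have hn : ∀ᶠ y in 𝓝 x, gramOp (E := E) x y ∈ Set.range ((↑) : (E ≃L[ℝ] E) → E →L[ℝ] E) := by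
    refine (contMDiffAt_gramOp x).continuousAt.eventually ?_
    rw [← he]
    exact ContinuousLinearEquiv.nhds e
  filter_upwards [eventually_mem_baseSet E x, hn] with y hy ⟨e', he'⟩
  have := gramOp_apply x y (coord E x y (σ y))
  rw [frame_coord hy] at this
  rw [← this, trivializationAt_eq_coord hy, ← he', ContinuousLinearMap.inverse_equiv]
  simp

theorem contMDiffAt_leviCivita (hX : CMDiffAt ∞ (T% X) x) (hY : CMDiffAt ∞ (T% Y) x) :
    CMDiffAt ∞ (T% (fun y => leviCivita E M Y y (X y))) x := by
  refine contMDiffAt_section_of_inner fun ξ => ?_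
  have hZ := contMDiffAt_frame (mem_baseSet_self E x) ξ
  refine ((contMDiffAt_const (c := (1 / 2 : ℝ))).mul (contMDiffAt_koszul hX hY hZ)).congr_of_eventuallyEq ?_
  filter_upwards [hX.eventually_mdifferentiableAt (by simp), hY.eventually_mdifferentiableAt (by simp),
    hZ.eventually_mdifferentiableAt (by simp)] with y h1 h2 h3
  simp [← two_mul_inner_leviCivita h1 h2 h3]

/-- In coordinates, `∇_u X` is the derivative of the coordinates plus a zeroth order term. -/
lemma leviCivita_eq (hX : MDiffAt (T% X) x) (u : TangentSpace 𝓘(ℝ, E) x) :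
    leviCivita E M X x u =
      frame x x (mvfderiv 𝓘(ℝ, E) (fun y => coord E x y (X y)) x u)
        + leviCivita E M (FiberBundle.extend E (X x)) x u := by
  have hcov := (leviCivita E M).isCovariantDerivativeOn (s := Set.univ)
  have hd {σ : Π x : M, TangentSpace 𝓘(ℝ, E) x} (hσ : MDiffAt (T% σ) x) :
      MDifferentiableAt 𝓘(ℝ, E) 𝓘(ℝ, E) (fun y => coord E x y (σ y)) x :=
    (mdifferentiableAt_along_iff.1 hσ).2
  -- The Leibniz terms cancel in this difference, so it depends on `X x` only and may be evaluated
  -- on the constant-coordinate extension, whose coordinates have zero derivative.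
  have ht : TensorialAt 𝓘(ℝ, E) E (fun X : Π x : M, TangentSpace 𝓘(ℝ, E) x =>
      leviCivita E M X x u - frame x x (mvfderiv 𝓘(ℝ, E) (fun y => coord E x y (X y)) x u)) x :=
    { smul := fun {f σ} hf hσ => by
        have : (fun y => coord E x y ((f • σ) y)) = f • fun y => coord E x y (σ y) := by
          ext y; simp
        rw [this, mvfderiv_smul hf (hd hσ), hcov.leibniz hσ hf]
        simp [smul_sub]
      add := fun {σ σ'} hσ hσ' => by
        have : (fun y => coord E x y ((σ + σ') y)) =
            (fun y => coord E x y (σ y)) + fun y => coord E x y (σ' y) := by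
          ext y; simp
        rw [this, mvfderiv_add (hd hσ) (hd hσ'), hcov.add hσ hσ']
        simp only [add_apply, map_add]
        abel }
  have hext : MDiffAt (T% (FiberBundle.extend E (X x))) x :=
    FiberBundle.mdifferentiableAt_extend 𝓘(ℝ, E) E (X x)
  have h1 := ht.pointwise hX hext (by simp)
  have h2 : mvfderiv 𝓘(ℝ, E) (fun y => coord E x y (FiberBundle.extend E (X x) y)) x = 0 := by
    have : (fun y => coord E x y (FiberBundle.extend E (X x) y)) =ᶠ[𝓝 x]
        fun _ => coord E x x (X x) := by
      filter_upwards [eventually_mem_baseSet E x] with y hy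
      rw [extend_eq_frame hy, coord_frame hy]
    rw [this.mvfderiv_eq, mvfderiv_const]
  simp only [h2] at h1
  simp at h1
  rw [← h1]
  abel

end LeviCivitaRegularity

/-! ### The covariant derivative of vector fields along a map. -/

section Along

variable {E : Type*} [NormedAddCommGroup E] [NormedSpace ℝ E] [FiniteDimensional ℝ E]
  {M : Type*} [TopologicalSpace M] [ChartedSpace E M] [IsManifold 𝓘(ℝ, E) ∞ M]
  [RiemannianBundle (fun x : M => TangentSpace 𝓘(ℝ, E) x)]
  [IsContMDiffRiemannianBundle 𝓘(ℝ, E) ∞ E (fun x : M => TangentSpace 𝓘(ℝ, E) x)]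

lemma sum_repr_smul_frame {ι : Type*} [Fintype ι] (b : Module.Basis ι ℝ E) {x y : M}
    (hy : y ∈ (trivializationAt E (TangentSpace 𝓘(ℝ, E)) x).baseSet)
    (u : TangentSpace 𝓘(ℝ, E) y) :
    ∑ i, b.repr (coord E x y u) i • frame x y (b i) = u := by
  simp_rw [← map_smul]
  rw [← map_sum, b.sum_repr, frame_coord hy]

lemma leviCivita_extend (x : M) (u : TangentSpace 𝓘(ℝ, E) x) :
    leviCivita E M (FiberBundle.extend E u) x =
      leviCivita E M (fun y => frame x y (coord E x x u)) x :=
  (leviCivita E M).isCovariantDerivativeOn.congr_of_eventuallyEq (s := Set.univ)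
    (FiberBundle.mdifferentiableAt_extend 𝓘(ℝ, E) E u)
    ((contMDiffAt_frame (mem_baseSet_self E x) _).mdifferentiableAt (by simp)) Filter.univ_mem
    ((eventually_mem_baseSet E x).mono fun _ hy => extend_eq_frame hy u)

/-- The zeroth order part of the Levi-Civita connection in the preferred chart at `x`, as the map
`w ↦ (u ↦ ∇_u W)`, where `W` is the extension of `w` with constant coordinates. -/
def christoffel (x : M) :
    TangentSpace 𝓘(ℝ, E) x →ₗ[ℝ] TangentSpace 𝓘(ℝ, E) x →L[ℝ] TangentSpace 𝓘(ℝ, E) x where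
  toFun w := leviCivita E M (FiberBundle.extend E w) x
  map_add' w w' := by
    have h (ξ : E) : MDiffAt (T% (fun y : M => frame x y ξ)) x :=
      (contMDiffAt_frame (mem_baseSet_self E x) ξ).mdifferentiableAt (by simp)
    simp only [leviCivita_extend, map_add]
    exact (leviCivita E M).isCovariantDerivativeOn.add (s := Set.univ) (h _) (h _)
  map_smul' a w := by
    have h (ξ : E) : MDiffAt (T% (fun y : M => frame x y ξ)) x :=
      (contMDiffAt_frame (mem_baseSet_self E x) ξ).mdifferentiableAt (by simp)
    simp only [leviCivita_extend, map_smul, RingHom.id_apply]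
    exact (leviCivita E M).isCovariantDerivativeOn.smul_const (s := Set.univ) a (h _)

lemma christoffel_apply (x : M) (w u : TangentSpace 𝓘(ℝ, E) x) :
    christoffel x w u = leviCivita E M (FiberBundle.extend E w) x u := rfl

variable {E' : Type*} [NormedAddCommGroup E'] [NormedSpace ℝ E']
  {N : Type*} [TopologicalSpace N] [ChartedSpace E' N]

variable (E') in
/-- The covariant derivative along a map `c` of a vector field along `c`, in the direction `v`. -/
def covAlong (c : N → M) (W : Π r : N, TangentSpace 𝓘(ℝ, E) (c r)) (s : N)
    (v : TangentSpace 𝓘(ℝ, E') s) : TangentSpace 𝓘(ℝ, E) (c s) :=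
  frame (c s) (c s) (mvfderiv 𝓘(ℝ, E') (fun r => coord E (c s) (c r) (W r)) s v)
    + christoffel (c s) (W s) (mfderiv 𝓘(ℝ, E') 𝓘(ℝ, E) c s v)

variable (E') in
/-- Differentiability of a vector field along a map. -/
abbrev MDiffAlongAt (c : N → M) (W : Π r : N, TangentSpace 𝓘(ℝ, E) (c r)) (s : N) : Prop :=
  MDifferentiableAt 𝓘(ℝ, E') 𝓘(ℝ, E).tangent (fun r => (⟨c r, W r⟩ : TangentBundle 𝓘(ℝ, E) M)) s

variable (E') in
/-- Smoothness of a vector field along a map. -/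
abbrev SmoothAlongAt (c : N → M) (W : Π r : N, TangentSpace 𝓘(ℝ, E) (c r)) (s : N) : Prop :=
  ContMDiffAt 𝓘(ℝ, E') 𝓘(ℝ, E).tangent ∞ (fun r => (⟨c r, W r⟩ : TangentBundle 𝓘(ℝ, E) M)) s

variable {c : N → M} {W W' : Π r : N, TangentSpace 𝓘(ℝ, E) (c r)} {s : N}
  {X : Π x : M, TangentSpace 𝓘(ℝ, E) x}

lemma MDiffAlongAt.add (hW : MDiffAlongAt E' c W s) (hW' : MDiffAlongAt E' c W' s) :
    MDiffAlongAt E' c (W + W') s := by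
  rw [MDiffAlongAt, mdifferentiableAt_along_iff] at *
  refine ⟨hW.1, ?_⟩
  simpa using! hW.2.add hW'.2

lemma MDiffAlongAt.smul {h : N → ℝ} (hh : MDifferentiableAt 𝓘(ℝ, E') 𝓘(ℝ, ℝ) h s)
    (hW : MDiffAlongAt E' c W s) : MDiffAlongAt E' c (fun r => h r • W r) s := by
  rw [MDiffAlongAt, mdifferentiableAt_along_iff] at *
  refine ⟨hW.1, ?_⟩
  simpa using! hh.smul hW.2

lemma SmoothAlongAt.add (hW : SmoothAlongAt E' c W s) (hW' : SmoothAlongAt E' c W' s) :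
    SmoothAlongAt E' c (fun r => W r + W' r) s := by
  rw [SmoothAlongAt, contMDiffAt_along_iff] at *
  refine ⟨hW.1, ?_⟩
  simpa using! hW.2.add hW'.2

lemma SmoothAlongAt.smul {h : N → ℝ} (hh : ContMDiffAt 𝓘(ℝ, E') 𝓘(ℝ, ℝ) ∞ h s)
    (hW : SmoothAlongAt E' c W s) : SmoothAlongAt E' c (fun r => h r • W r) s := by
  rw [SmoothAlongAt, contMDiffAt_along_iff] at *
  refine ⟨hW.1, ?_⟩
  simpa using! hh.smul hW.2

lemma SmoothAlongAt.sum {ι : Type*} (I : Finset ι) (hc : ContMDiffAt 𝓘(ℝ, E') 𝓘(ℝ, E) ∞ c s)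
    {V : ι → Π r : N, TangentSpace 𝓘(ℝ, E) (c r)} (hV : ∀ i ∈ I, SmoothAlongAt E' c (V i) s) :
    SmoothAlongAt E' c (fun r => ∑ i ∈ I, V i r) s := by
  rw [SmoothAlongAt, contMDiffAt_along_iff]
  refine ⟨hc, ?_⟩
  simp only [map_sum]
  exact ContMDiffAt.sum fun i hi => (contMDiffAt_along_iff.1 (hV i hi)).2

lemma SmoothAlongAt.comp (hc : ContMDiffAt 𝓘(ℝ, E') 𝓘(ℝ, E) ∞ c s)
    (hX : CMDiffAt ∞ (T% X) (c s)) : SmoothAlongAt E' c (fun r => X (c r)) s :=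
  ContMDiffAt.comp s hX hc

lemma MDiffAlongAt.comp (hc : MDifferentiableAt 𝓘(ℝ, E') 𝓘(ℝ, E) c s)
    (hX : MDiffAt (T% X) (c s)) : MDiffAlongAt E' c (fun r => X (c r)) s :=
  MDifferentiableAt.comp s hX hc

lemma SmoothAlongAt.mdiffAlongAt (hW : SmoothAlongAt E' c W s) : MDiffAlongAt E' c W s :=
  hW.mdifferentiableAt (by simp)

lemma SmoothAlongAt.congr (hW : SmoothAlongAt E' c W s) (h : ∀ᶠ r in 𝓝 s, W' r = W r) :
    SmoothAlongAt E' c W' s :=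
  ContMDiffAt.congr_of_eventuallyEq hW (h.mono fun r hr => by simp only [hr])

lemma covAlong_congr (h : ∀ᶠ r in 𝓝 s, W' r = W r) :
    covAlong E' c W' s = covAlong E' c W s := by
  ext v
  have h1 : (fun r => coord E (c s) (c r) (W' r)) =ᶠ[𝓝 s] fun r => coord E (c s) (c r) (W r) :=
    h.mono fun r hr => by simp only [hr]
  rw [covAlong, covAlong, h1.mvfderiv_eq, h.self_of_nhds]

lemma covAlong_add (hW : MDiffAlongAt E' c W s) (hW' : MDiffAlongAt E' c W' s)
    (v : TangentSpace 𝓘(ℝ, E') s) :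
    covAlong E' c (W + W') s v = covAlong E' c W s v + covAlong E' c W' s v := by
  have h : (fun r => coord E (c s) (c r) ((W + W') r)) =
      (fun r => coord E (c s) (c r) (W r)) + fun r => coord E (c s) (c r) (W' r) := by
    ext r; simp
  rw [covAlong, covAlong, covAlong, h, mvfderiv_add (mdifferentiableAt_along_iff.1 hW).2
    (mdifferentiableAt_along_iff.1 hW').2]
  simp only [Pi.add_apply, map_add, add_apply]
  abel

lemma covAlong_smul {h : N → ℝ} (hh : MDifferentiableAt 𝓘(ℝ, E') 𝓘(ℝ, ℝ) h s)
    (hW : MDiffAlongAt E' c W s) (v : TangentSpace 𝓘(ℝ, E') s) :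
    covAlong E' c (fun r => h r • W r) s v =
      h s • covAlong E' c W s v + mvfderiv 𝓘(ℝ, E') h s v • W s := by
  have h1 : (fun r => coord E (c s) (c r) (h r • W r)) =
      h • fun r => coord E (c s) (c r) (W r) := by
    ext r; simp
  rw [covAlong, covAlong, h1, mvfderiv_smul hh (mdifferentiableAt_along_iff.1 hW).2]
  simp only [map_smul, add_apply, smul_apply, ContinuousLinearMap.smulRight_apply, map_add,
    smul_add, frame_coord_self]
  abel

lemma covAlong_zero (v : TangentSpace 𝓘(ℝ, E') s) : covAlong E' c (fun r => (0 : TangentSpace 𝓘(ℝ, E) (c r))) s v = 0 := by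
  simp [covAlong, mvfderiv_const]

lemma covAlong_sum {ι : Type*} (I : Finset ι) (hc : MDifferentiableAt 𝓘(ℝ, E') 𝓘(ℝ, E) c s)
    {V : ι → Π r : N, TangentSpace 𝓘(ℝ, E) (c r)}
    (hV : ∀ i ∈ I, MDiffAlongAt E' c (V i) s) (v : TangentSpace 𝓘(ℝ, E') s) :
    covAlong E' c (fun r => ∑ i ∈ I, V i r) s v = ∑ i ∈ I, covAlong E' c (V i) s v := by
  classical
  -- Differentiability of the partial sums is carried along because additivity requires it; for the
  -- empty sum it amounts to `hc`.
  have key : MDiffAlongAt E' c (fun r => ∑ i ∈ I, V i r) s ∧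
      covAlong E' c (fun r => ∑ i ∈ I, V i r) s v = ∑ i ∈ I, covAlong E' c (V i) s v := by
    induction I using Finset.induction_on with
    | empty =>
      simp only [Finset.sum_empty]
      refine ⟨mdifferentiableAt_along_iff.2 ⟨hc, ?_⟩, covAlong_zero v⟩
      simpa using! mdifferentiableAt_const
    | insert a I ha ih =>
      obtain ⟨h1, h2⟩ := ih fun i hi => hV i (Finset.mem_insert_of_mem hi)
      have h3 := hV a (Finset.mem_insert_self a I)
      simp only [Finset.sum_insert ha, ← h2]
      exact ⟨h3.add h1, covAlong_add h3 h1 v⟩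
  exact key.2

/-- The chain rule handles the derivative of the coordinates; the zeroth order terms agree by
`leviCivita_eq`. -/
lemma covAlong_comp (hc : MDifferentiableAt 𝓘(ℝ, E') 𝓘(ℝ, E) c s) (hX : MDiffAt (T% X) (c s))
    (v : TangentSpace 𝓘(ℝ, E') s) :
    covAlong E' c (fun r => X (c r)) s v =
      leviCivita E M X (c s) (mfderiv 𝓘(ℝ, E') 𝓘(ℝ, E) c s v) := by
  rw [leviCivita_eq hX, covAlong, christoffel_apply]
  congr 2
  have h1 : MDifferentiableAt 𝓘(ℝ, E) 𝓘(ℝ, E) (fun y => coord E (c s) y (X y)) (c s) :=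
    (mdifferentiableAt_along_iff.1 hX).2
  exact congrArg (fun L : E' →L[ℝ] E => L v) (mfderiv_comp s h1 hc)

end Along

/-! ### Smoothness of covariant derivatives along a curve. -/

section Curve

variable {E : Type*} [NormedAddCommGroup E] [NormedSpace ℝ E] [FiniteDimensional ℝ E]
  {M : Type*} [TopologicalSpace M] [ChartedSpace E M] [IsManifold 𝓘(ℝ, E) ∞ M]
  [RiemannianBundle (fun x : M => TangentSpace 𝓘(ℝ, E) x)]
  [IsContMDiffRiemannianBundle 𝓘(ℝ, E) ∞ E (fun x : M => TangentSpace 𝓘(ℝ, E) x)]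

variable {γ : ℝ → M} {V : Π t : ℝ, TangentSpace 𝓘(ℝ, E) (γ t)} {t : ℝ}

/-- The unit vector field on the real line. -/
def unitField (t : ℝ) : TangentSpace 𝓘(ℝ, ℝ) t := (1 : ℝ)

lemma contMDiffAt_unitField {t : ℝ} : CMDiffAt ∞ (T% unitField) t := by
  rw [contMDiffAt_section]
  simpa [unitField] using! contMDiffAt_const

lemma covDerivAlong_eq_covAlong (hγ : ContinuousAt γ t) :
    covDerivAlong E γ V t = covAlong ℝ γ V t (unitField t) := by
  have h : (fun s : ℝ => (trivializationAt E (TangentSpace 𝓘(ℝ, E)) (γ t) ⟨γ s, V s⟩).2) =ᶠ[𝓝 t]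
      fun s => coord E (γ t) (γ s) (V s) :=
    (eventually_comp_mem_baseSet (E := E) hγ).mono fun s hs => trivializationAt_eq_coord hs (V s)
  unfold covDerivAlong covAlong
  rw [symm_eq_frame (mem_baseSet_self E (γ t)), h.deriv_eq]
  congr 2
  rw [mvfderiv, mfderiv_eq_fderiv]
  rfl

lemma smoothAlongAt_velocity (hγ : ContMDiff 𝓘(ℝ, ℝ) 𝓘(ℝ, E) ∞ γ) :
    SmoothAlongAt ℝ γ (velocity E γ) t := by
  have h1 : ContMDiff 𝓘(ℝ, ℝ).tangent 𝓘(ℝ, E).tangent ∞ (tangentMap 𝓘(ℝ, ℝ) 𝓘(ℝ, E) γ) :=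
    hγ.contMDiff_tangentMap (by simp)
  have h2 : ContMDiff 𝓘(ℝ, ℝ) 𝓘(ℝ, ℝ).tangent ∞
      (fun t : ℝ => (⟨t, unitField t⟩ : TangentBundle 𝓘(ℝ, ℝ) ℝ)) := fun _ => contMDiffAt_unitField
  exact (h1.comp h2) t

/-- The definition of `D_t V` at `r` uses the trivialization at `γ r`, which moves with `r`, so
smoothness cannot be read off it. The product and chain rules rewrite it in one fixed frame `S i`,
as the sum of `a_i ∑_k g_k ∇_{S_k} S_i + a_i' S_i`, with smooth ingredients. -/
theorem smoothAlongAt_covDerivAlong (hγ : ContMDiff 𝓘(ℝ, ℝ) 𝓘(ℝ, E) ∞ γ)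
    (hV : SmoothAlongAt ℝ γ V t) : SmoothAlongAt ℝ γ (covDerivAlong E γ V) t := by
  let b := Module.finBasis ℝ E
  let S (i) (y : M) : TangentSpace 𝓘(ℝ, E) y := frame (γ t) y (b i)
  let a (i) (r : ℝ) : ℝ := b.repr (coord E (γ t) (γ r) (V r)) i
  let g (i) (r : ℝ) : ℝ := b.repr (coord E (γ t) (γ r) (velocity E γ r)) i
  have hS (i) {y : M} (hy : y ∈ (trivializationAt E (TangentSpace 𝓘(ℝ, E)) (γ t)).baseSet) :
      CMDiffAt ∞ (T% (S i)) y := contMDiffAt_frame hy _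
  have hcoef (i) {U : Π r : ℝ, TangentSpace 𝓘(ℝ, E) (γ r)} (hU : SmoothAlongAt ℝ γ U t) :
      ContMDiffAt 𝓘(ℝ, ℝ) 𝓘(ℝ, ℝ) ∞ (fun r => b.repr (coord E (γ t) (γ r) (U r)) i) t :=
    (b.coord i).toContinuousLinearMap.contMDiff.contMDiffAt.comp t (contMDiffAt_along_iff.1 hU).2
  have hdec {U : Π r : ℝ, TangentSpace 𝓘(ℝ, E) (γ r)} {r : ℝ}
      (hr : γ r ∈ (trivializationAt E (TangentSpace 𝓘(ℝ, E)) (γ t)).baseSet) :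
      U r = ∑ i, b.repr (coord E (γ t) (γ r) (U r)) i • S i (γ r) := (sum_repr_smul_frame b hr _).symm
  have ha (i) : ContMDiffAt 𝓘(ℝ, ℝ) 𝓘(ℝ, ℝ) ∞ (a i) t := hcoef i hV
  have hg (i) : ContMDiffAt 𝓘(ℝ, ℝ) 𝓘(ℝ, ℝ) ∞ (g i) t := hcoef i (smoothAlongAt_velocity hγ)
  have hmem := (eventually_comp_mem_baseSet (E := E) hγ.continuous.continuousAt (s := t))
  -- Openness makes the frame expansion valid around each nearby `r`, as differentiating there
  -- requires.
  have hB : IsOpen {r | γ r ∈ (trivializationAt E (TangentSpace 𝓘(ℝ, E)) (γ t)).baseSet} :=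
    (Trivialization.open_baseSet _).preimage hγ.continuous
  have heq : ∀ᶠ r in 𝓝 t, covDerivAlong E γ V r = ∑ i, (a i r • (∑ k, g k r •
      leviCivita E M (S i) (γ r) (S k (γ r))) + mvfderiv 𝓘(ℝ, ℝ) (a i) r (unitField r) • S i (γ r)) := by
    have hd : ∀ᶠ r in 𝓝 t, ∀ i, MDifferentiableAt 𝓘(ℝ, ℝ) 𝓘(ℝ, ℝ) (a i) r :=
      Filter.eventually_all.2 fun i => (ha i).eventually_mdifferentiableAt (by simp)
    filter_upwards [hmem, hd] with r hr hdr
    have hγr : MDifferentiableAt 𝓘(ℝ, ℝ) 𝓘(ℝ, E) γ r := (hγ r).mdifferentiableAt (by simp)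
    have hSr (i) : MDiffAt (T% (S i)) (γ r) := (hS i hr).mdifferentiableAt (by simp)
    have hSγ (i) : MDiffAlongAt ℝ γ (fun r => S i (γ r)) r := .comp hγr (hSr i)
    rw [covDerivAlong_eq_covAlong hγ.continuous.continuousAt,
      covAlong_congr (W := fun r => ∑ i, a i r • S i (γ r))
        ((hB.eventually_mem hr).mono fun r' hr' => hdec hr'),
      covAlong_sum _ hγr fun i _ => (hSγ i).smul (hdr i)]
    refine Finset.sum_congr rfl fun i _ => ?_
    rw [covAlong_smul (hdr i) (hSγ i), covAlong_comp hγr (hSr i)]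
    congr 2
    change leviCivita E M (S i) (γ r) (velocity E γ r) = _
    rw [hdec (U := velocity E γ) hr, map_sum]
    simp [g]
  refine SmoothAlongAt.congr ?_ heq
  refine SmoothAlongAt.sum _ (hγ t) fun i _ => ?_
  have hSi := hS i (mem_baseSet_self E (γ t))
  refine SmoothAlongAt.add (.smul (ha i) (.sum _ (hγ t) fun k _ => .smul (hg k) ?_))
    (.smul ((ha i).mvfderiv_apply contMDiffAt_unitField (by simp)) (.comp (hγ t) hSi))
  exact SmoothAlongAt.comp (hγ t) (contMDiffAt_leviCivita (hS k (mem_baseSet_self E (γ t))) hSi)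

end Curve

/-! ### Tensor fields, their covariant derivatives and the product rule. -/

section Tensor

variable {E : Type*} [NormedAddCommGroup E] [NormedSpace ℝ E] [FiniteDimensional ℝ E]
  {M : Type*} [TopologicalSpace M] [ChartedSpace E M] [IsManifold 𝓘(ℝ, E) ∞ M]
  [RiemannianBundle (fun x : M => TangentSpace 𝓘(ℝ, E) x)]
  [IsContMDiffRiemannianBundle 𝓘(ℝ, E) ∞ E (fun x : M => TangentSpace 𝓘(ℝ, E) x)]

/-- A field of covariant `k`-tensors of class `C^n`. -/
structure IsTensorField (n : ℕ) {k : ℕ} (T : Π x : M, (Fin k → TangentSpace 𝓘(ℝ, E) x) → ℝ) :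
    Prop where
  multilinear : ∀ x, ∃ m : MultilinearMap ℝ (fun _ : Fin k => TangentSpace 𝓘(ℝ, E) x) ℝ,
    ∀ u, m u = T x u
  contMDiffAt : ∀ {U : Fin k → Π x : M, TangentSpace 𝓘(ℝ, E) x} {x : M},
    (∀ l, CMDiffAt ∞ (T% (U l)) x) → ContMDiffAt 𝓘(ℝ, E) 𝓘(ℝ, ℝ) n (fun y => T y (U · y)) x

lemma multilinearMap_sum_smul {ι V : Type*} [Fintype ι] [AddCommGroup V] [Module ℝ V] {k : ℕ}
    (m : MultilinearMap ℝ (fun _ : Fin k => V) ℝ) (α : Fin k → ι → ℝ) (e : ι → V) :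
    m (fun l => ∑ i, α l i • e i) =
      ∑ J : Fin k → ι, (∏ l, α l (J l)) * m (fun l => e (J l)) := by
  classical
  rw [MultilinearMap.map_sum]
  exact Finset.sum_congr rfl fun J _ => m.map_smul_univ _ _

variable {n k : ℕ} {T : Π x : M, (Fin k → TangentSpace 𝓘(ℝ, E) x) → ℝ} {x : M}

/-- The components of a tensor field in the preferred trivialization at `x`. -/
def tensorComp (T : Π x : M, (Fin k → TangentSpace 𝓘(ℝ, E) x) → ℝ) (x : M)
    (J : Fin k → Fin (Module.finrank ℝ E)) (y : M) : ℝ :=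
  T y fun l => frame x y (Module.finBasis ℝ E (J l))

variable (E) in
/-- The components of a tangent vector in the preferred trivialization at `x`. -/
def vecComp (x y : M) (i : Fin (Module.finrank ℝ E)) : TangentSpace 𝓘(ℝ, E) y →L[ℝ] ℝ :=
  ((Module.finBasis ℝ E).coord i).toContinuousLinearMap ∘L coord E x y

lemma sum_vecComp_smul {x y : M}
    (hy : y ∈ (trivializationAt E (TangentSpace 𝓘(ℝ, E)) x).baseSet) (u : TangentSpace 𝓘(ℝ, E) y) :
    ∑ i, vecComp E x y i u • frame x y (Module.finBasis ℝ E i) = u :=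
  sum_repr_smul_frame (Module.finBasis ℝ E) hy u

lemma IsTensorField.eq_sum (hT : IsTensorField n T) {x y : M}
    (hy : y ∈ (trivializationAt E (TangentSpace 𝓘(ℝ, E)) x).baseSet)
    (u : Fin k → TangentSpace 𝓘(ℝ, E) y) :
    T y u = ∑ J, (∏ l, vecComp E x y (J l) (u l)) * tensorComp T x J y := by
  obtain ⟨m, hm⟩ := hT.multilinear y
  simp only [tensorComp, ← hm]
  rw [← multilinearMap_sum_smul m (fun l i => vecComp E x y i (u l))
    fun i => frame x y (Module.finBasis ℝ E i)]
  simp only [sum_vecComp_smul hy]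

lemma IsTensorField.mdifferentiableAt_tensorComp (hT : IsTensorField (n + 1) T) (x : M)
    (J : Fin k → Fin (Module.finrank ℝ E)) :
    MDifferentiableAt 𝓘(ℝ, E) 𝓘(ℝ, ℝ) (tensorComp T x J) x :=
  (hT.contMDiffAt fun _ => contMDiffAt_frame (mem_baseSet_self E x) _).mdifferentiableAt (by simp)

section Derivation

variable {E' : Type*} [NormedAddCommGroup E'] [NormedSpace ℝ E']
  {N : Type*} [TopologicalSpace N] [ChartedSpace E' N] {s : N}

lemma mvfderiv_finset_sum {ι : Type*} (I : Finset ι) {f : ι → N → ℝ}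
    (hf : ∀ i ∈ I, MDifferentiableAt 𝓘(ℝ, E') 𝓘(ℝ, ℝ) (f i) s) :
    MDifferentiableAt 𝓘(ℝ, E') 𝓘(ℝ, ℝ) (fun r => ∑ i ∈ I, f i r) s ∧
    mvfderiv 𝓘(ℝ, E') (fun r => ∑ i ∈ I, f i r) s = ∑ i ∈ I, mvfderiv 𝓘(ℝ, E') (f i) s := by
  classical
  induction I using Finset.induction_on with
  | empty => simpa using! ⟨mdifferentiableAt_const, mvfderiv_const 0⟩
  | insert a I ha ih =>
    obtain ⟨h1, h2⟩ := ih fun i hi => hf i (Finset.mem_insert_of_mem hi)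
    have h3 := hf a (Finset.mem_insert_self a I)
    simp only [Finset.sum_insert ha, ← h2]
    exact ⟨h3.add h1, mvfderiv_add h3 h1⟩

lemma mvfderiv_finset_prod {ι : Type*} [DecidableEq ι] (I : Finset ι) {f : ι → N → ℝ}
    (hf : ∀ i ∈ I, MDifferentiableAt 𝓘(ℝ, E') 𝓘(ℝ, ℝ) (f i) s) :
    MDifferentiableAt 𝓘(ℝ, E') 𝓘(ℝ, ℝ) (fun r => ∏ i ∈ I, f i r) s ∧
    mvfderiv 𝓘(ℝ, E') (fun r => ∏ i ∈ I, f i r) s =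
      ∑ i ∈ I, (∏ j ∈ I.erase i, f j s) • mvfderiv 𝓘(ℝ, E') (f i) s := by
  induction I using Finset.induction_on with
  | empty => simpa using! ⟨mdifferentiableAt_const, mvfderiv_const 1⟩
  | insert a I ha ih =>
    obtain ⟨h1, h2⟩ := ih fun i hi => hf i (Finset.mem_insert_of_mem hi)
    have h3 := hf a (Finset.mem_insert_self a I)
    simp only [Finset.prod_insert ha, Finset.sum_insert ha]
    refine ⟨h3.mul h1, ?_⟩
    rw [mvfderiv_fun_mul h3 h1, h2, Finset.erase_insert ha, Finset.smul_sum, add_comm]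
    congr 1
    refine Finset.sum_congr rfl fun i hi => ?_
    have hia : a ≠ i := fun h => ha (h ▸ hi)
    rw [Finset.erase_insert_of_ne hia, Finset.prod_insert (fun h => ha (Finset.mem_of_mem_erase h)),
      smul_smul]

end Derivation

/-- The extended arguments have constant coordinates near `x`, so only the components of `T` get
differentiated. The outcome is visibly multilinear in `u` and `w`. -/
lemma IsTensorField.tensorCovDeriv_cons (hT : IsTensorField (n + 1) T)
    (u : TangentSpace 𝓘(ℝ, E) x) (w : Fin k → TangentSpace 𝓘(ℝ, E) x) :
    tensorCovDeriv T x (Fin.cons u w : Fin (k + 1) → TangentSpace 𝓘(ℝ, E) x) =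
      ∑ J, (∏ l, vecComp E x x (J l) (w l)) * mvfderiv 𝓘(ℝ, E) (tensorComp T x J) x u
        - ∑ l, T x (Function.update w l (christoffel x (w l) u)) := by
  unfold tensorCovDeriv
  simp only [Fin.cons_zero, Fin.cons_succ, ← christoffel_apply]
  congr 1
  have h1 : (fun y => T y (fun i => FiberBundle.extend E (w i) y)) =ᶠ[𝓝 x]
      fun y => ∑ J, (∏ l, vecComp E x x (J l) (w l)) * tensorComp T x J y := by
    filter_upwards [eventually_mem_baseSet E x] with y hy
    rw [hT.eq_sum hy]
    simp only [extend_eq_frame hy, vecComp, ContinuousLinearMap.comp_apply, coord_frame hy]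
  have h2 (J : Fin k → Fin (Module.finrank ℝ E)) : MDifferentiableAt 𝓘(ℝ, E) 𝓘(ℝ, ℝ)
      (fun _ : M => ∏ l, vecComp E x x (J l) (w l)) x := mdifferentiableAt_const
  rw [h1.mvfderiv_eq, (mvfderiv_finset_sum Finset.univ
    (f := fun J y => (∏ l, vecComp E x x (J l) (w l)) * tensorComp T x J y) fun J _ =>
    (h2 J).mul (hT.mdifferentiableAt_tensorComp x J)).2, sum_apply]
  refine Finset.sum_congr rfl fun J _ => ?_
  rw [mvfderiv_fun_mul (h2 J) (hT.mdifferentiableAt_tensorComp x J), mvfderiv_const]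
  simp

lemma IsTensorField.multilinear_tensorCovDeriv (hT : IsTensorField (n + 1) T) (x : M) :
    ∃ m : MultilinearMap ℝ (fun _ : Fin (k + 1) => TangentSpace 𝓘(ℝ, E) x) ℝ,
      ∀ u, m u = tensorCovDeriv T x u := by
  obtain ⟨m, hm⟩ := hT.multilinear x
  let θ (J : Fin k → Fin (Module.finrank ℝ E)) :
      MultilinearMap ℝ (fun _ : Fin k => TangentSpace 𝓘(ℝ, E) x) ℝ :=
    (MultilinearMap.mkPiAlgebra ℝ (Fin k) ℝ).compLinearMap
      fun l => (vecComp E x x (J l)).toLinearMap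
  let A : TangentSpace 𝓘(ℝ, E) x →ₗ[ℝ] TangentSpace 𝓘(ℝ, E) x →ₗ[ℝ] TangentSpace 𝓘(ℝ, E) x :=
    ((ContinuousLinearMap.coeLM ℝ).comp (christoffel x)).flip
  -- The differentiation direction is separated off as a linear variable. In the second sum, `m` is
  -- precomposed with the identity in every slot except `l`, where `A u` acts.
  let L : TangentSpace 𝓘(ℝ, E) x →ₗ[ℝ]
      MultilinearMap ℝ (fun _ : Fin k => TangentSpace 𝓘(ℝ, E) x) ℝ :=
    ∑ J, (mvfderiv 𝓘(ℝ, E) (tensorComp T x J) x).toLinearMap.smulRight (θ J)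
      - ∑ l, (LinearMap.applyₗ m) ∘ₗ
        ((MultilinearMap.compLinearMapMultilinear (R := ℝ)).toLinearMap
          (fun _ => LinearMap.id) l) ∘ₗ A
  refine ⟨L.uncurryLeft, fun u => ?_⟩
  rw [← Fin.cons_self_tail u, hT.tensorCovDeriv_cons]
  simp only [LinearMap.uncurryLeft_apply, L, Fin.cons_zero, Fin.tail_cons, ← hm,
    LinearMap.sub_apply, LinearMap.sum_apply, sub_apply, sum_apply]
  congr 1
  · refine Finset.sum_congr rfl fun J _ => ?_
    simp [θ, mul_comm]
  · refine Finset.sum_congr rfl fun l _ => ?_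
    simp only [LinearMap.comp_apply, LinearMap.applyₗ_apply_apply, MultilinearMap.toLinearMap_apply,
      MultilinearMap.compLinearMapMultilinear_apply]
    rw [MultilinearMap.compLinearMapₗ_apply, MultilinearMap.compLinearMap_apply]
    refine congrArg m (funext fun j => ?_)
    rcases eq_or_ne j l with rfl | hj
    · simp [A]
    · simp [hj]

/-- In components this is the ordinary product rule; the Christoffel terms subtracted in `∇T` cancel
those added by the covariant derivatives of the arguments. A general source `N` serves both for
curves and for `c = id`, where it describes `∇T` on arbitrary fields. -/
theorem IsTensorField.mvfderiv_along {E' : Type*} [NormedAddCommGroup E'] [NormedSpace ℝ E']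
    {N : Type*} [TopologicalSpace N] [ChartedSpace E' N] {s : N} {c : N → M}
    {W : Fin k → Π r : N, TangentSpace 𝓘(ℝ, E) (c r)} (hT : IsTensorField (n + 1) T)
    (hc : MDifferentiableAt 𝓘(ℝ, E') 𝓘(ℝ, E) c s) (hW : ∀ l, MDiffAlongAt E' c (W l) s)
    (v : TangentSpace 𝓘(ℝ, E') s) :
    MDifferentiableAt 𝓘(ℝ, E') 𝓘(ℝ, ℝ) (fun r => T (c r) (W · r)) s ∧
    mvfderiv 𝓘(ℝ, E') (fun r => T (c r) (W · r)) s v =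
      tensorCovDeriv T (c s) (Fin.cons (mfderiv 𝓘(ℝ, E') 𝓘(ℝ, E) c s v) (W · s) :
        Fin (k + 1) → TangentSpace 𝓘(ℝ, E) (c s))
      + ∑ l, T (c s) (Function.update (W · s) l (covAlong E' c (W l) s v)) := by
  have hx := mem_baseSet_self E (c s)
  let a (l i) (r : N) : ℝ := vecComp E (c s) (c r) i (W l r)
  have ha (l i) : MDifferentiableAt 𝓘(ℝ, E') 𝓘(ℝ, ℝ) (a l i) s :=
    ((Module.finBasis ℝ E).coord i).toContinuousLinearMap.mdifferentiableAt.comp s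
      (mdifferentiableAt_along_iff.1 (hW l)).2
  have hda (l i) : mvfderiv 𝓘(ℝ, E') (a l i) s v = (Module.finBasis ℝ E).repr
      (mvfderiv 𝓘(ℝ, E') (fun r => coord E (c s) (c r) (W l r)) s v) i := by
    have h1 := ((Module.finBasis ℝ E).coord i).toContinuousLinearMap.mdifferentiableAt
      (x := coord E (c s) (c s) (W l s))
    have h2 := mfderiv_comp s h1 (mdifferentiableAt_along_iff.1 (hW l)).2
    rw [ContinuousLinearMap.mfderiv_eq] at h2
    exact congrArg (fun L : E' →L[ℝ] ℝ => L v) h2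
  have hcomp (J) := hT.mdifferentiableAt_tensorComp (c s) J
  have hTc (J) : MDifferentiableAt 𝓘(ℝ, E') 𝓘(ℝ, ℝ) (fun r => tensorComp T (c s) J (c r)) s :=
    (hcomp J).comp s hc
  have hdTc (J) : mvfderiv 𝓘(ℝ, E') (fun r => tensorComp T (c s) J (c r)) s v =
      mvfderiv 𝓘(ℝ, E) (tensorComp T (c s) J) (c s) (mfderiv 𝓘(ℝ, E') 𝓘(ℝ, E) c s v) :=
    mvfderiv_comp_apply s (hcomp J) hc v
  have heq : (fun r => T (c r) (W · r)) =ᶠ[𝓝 s]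
      fun r => ∑ J, (∏ l, a l (J l) r) * tensorComp T (c s) J (c r) := by
    filter_upwards [eventually_comp_mem_baseSet (E := E) hc.continuousAt] with r hr
    exact hT.eq_sum hr _
  have hprod (J : Fin k → Fin (Module.finrank ℝ E)) :=
    mvfderiv_finset_prod (E' := E') Finset.univ fun l (_ : l ∈ Finset.univ) => ha l (J l)
  have hsum := mvfderiv_finset_sum (E' := E') Finset.univ
    (f := fun J r => (∏ l, a l (J l) r) * tensorComp T (c s) J (c r))
    fun J (_ : J ∈ Finset.univ) => (hprod J).1.mul (hTc J)
  refine ⟨heq.mdifferentiableAt_iff.2 hsum.1, ?_⟩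
  -- Splits slot `l` into the derivative of the coordinates, which matches one term of the product
  -- rule, and the Christoffel part, which is to cancel.
  have hupd (l) : T (c s) (Function.update (W · s) l (covAlong E' c (W l) s v)) =
      (∑ J, (mvfderiv 𝓘(ℝ, E') (a l (J l)) s v * ∏ j ∈ Finset.univ.erase l, a j (J j) s) *
        tensorComp T (c s) J (c s)) + T (c s) (Function.update (W · s) l
          (christoffel (c s) (W l s) (mfderiv 𝓘(ℝ, E') 𝓘(ℝ, E) c s v))) := by
    obtain ⟨m, hm⟩ := hT.multilinear (c s)
    rw [covAlong, ← hm, m.map_update_add, hm, hm, hT.eq_sum hx]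
    congr 1
    refine Finset.sum_congr rfl fun J _ => ?_
    rw [← Finset.mul_prod_erase _ _ (Finset.mem_univ l), hda]
    congr 2
    · simp [vecComp]
    · refine Finset.prod_congr rfl fun j hj => ?_
      simp [Finset.ne_of_mem_erase hj, a]
  rw [heq.mvfderiv_eq, hsum.2, hT.tensorCovDeriv_cons, Finset.sum_congr rfl fun l _ => hupd l,
    Finset.sum_add_distrib, sub_add_add_cancel, Finset.sum_comm, ← Finset.sum_add_distrib,
    sum_apply]
  refine Finset.sum_congr rfl fun J _ => ?_
  rw [mvfderiv_fun_mul (hprod J).1 (hTc J), (hprod J).2]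
  simp only [add_apply, smul_apply, sum_apply, hdTc, smul_eq_mul, Finset.mul_sum]
  congr 1
  refine Finset.sum_congr rfl fun l _ => ?_
  ring

/-- The extensions in the definition vary with the base point. The product rule along `id` replaces
them by the given smooth fields `U`, leaving one derivative of a `C^{n+1}` function and evaluations
of `T` on smooth fields. -/
theorem IsTensorField.tensorCovDeriv (hT : IsTensorField (n + 1) T) :
    IsTensorField n (tensorCovDeriv T) where
  multilinear := hT.multilinear_tensorCovDeriv
  contMDiffAt {U x} hU := by
    have h1 : ContMDiffAt 𝓘(ℝ, E) 𝓘(ℝ, ℝ) n (fun y => mvfderiv 𝓘(ℝ, E)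
        (fun z => T z fun l => U l.succ z) y (U 0 y)) x :=
      (hT.contMDiffAt fun l => hU l.succ).mvfderiv_apply ((hU 0).of_le (by exact_mod_cast le_top))
        (by simp)
    -- The argument fields with the `l`-th one replaced by its covariant derivative in direction `U
    -- 0`.
    let V (l j : Fin k) : Π x : M, TangentSpace 𝓘(ℝ, E) x :=
      Function.update (fun j => U j.succ) l (fun y => leviCivita E M (U l.succ) y (U 0 y)) j
    have hV (l j) : CMDiffAt ∞ (T% (V l j)) x := by
      rcases eq_or_ne j l with rfl | hj
      · simpa [V] using contMDiffAt_leviCivita (hU 0) (hU j.succ)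
      · simpa [V, hj] using hU j.succ
    have h2 (l) : ContMDiffAt 𝓘(ℝ, E) 𝓘(ℝ, ℝ) n (fun y => T y fun j => V l j y) x :=
      (hT.contMDiffAt (hV l)).of_le (by norm_cast; simp)
    refine (h1.sub (ContMDiffAt.sum fun l (_ : l ∈ Finset.univ) => h2 l)).congr_of_eventuallyEq ?_
    have hd : ∀ᶠ y in 𝓝 x, ∀ l, MDiffAt (T% (U l)) y :=
      Filter.eventually_all.2 fun l => (hU l).eventually_mdifferentiableAt (by simp)
    filter_upwards [hd] with y hy
    have h3 := (hT.mvfderiv_along (c := id) (W := fun l => U l.succ) mdifferentiableAt_id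
      (fun l => hy l.succ) (U 0 y)).2
    have h4 (l : Fin k) : covAlong E (id : M → M) (U l.succ) y (U 0 y) =
        leviCivita E M (U l.succ) y (U 0 y) := by
      have := covAlong_comp (E' := E) (c := (id : M → M)) (s := y) mdifferentiableAt_id (hy l.succ)
        (U 0 y)
      simpa using! this
    have h5 : (Fin.cons (mfderiv 𝓘(ℝ, E) 𝓘(ℝ, E) id y (U 0 y)) (fun l : Fin k => U l.succ y) :
        Fin (k + 1) → TangentSpace 𝓘(ℝ, E) y) = fun l => U l y := by
      ext l
      refine Fin.cases ?_ (fun i => ?_) l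
      · simp
      · simp
    have h6 (l : Fin k) : (fun j => V l j y) = Function.update (fun j : Fin k => U j.succ y) l
        (leviCivita E M (U l.succ) y (U 0 y)) := by
      ext j
      rcases eq_or_ne j l with rfl | hj
      · simp [V]
      · simp [V, hj]
    rw [← h5]
    simp only [h6, ← h4]
    exact (sub_eq_of_eq_add h3).symm

end Tensor

/-! ### From ordered set partitions to compositions. -/

section Combinatorics

/-- The Taylor series of `g ∘ f` and the formal composition of the two Taylor series coincide by
uniqueness; this compares their coefficients of order `n`. -/
lemma iteratedDeriv_comp_eq_sum_composition {f g : ℝ → ℝ} {x : ℝ} (hg : AnalyticAt ℝ g (f x))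
    (hf : AnalyticAt ℝ f x) (n : ℕ) :
    iteratedDeriv n (g ∘ f) x = n ! * ∑ c : Composition n,
      (iteratedDeriv c.length g (f x) / c.length !) *
        ∏ i, iteratedDeriv (c.blocksFun i) f x / (c.blocksFun i)! := by
  have h1 := (hg.hasFPowerSeriesAt.comp hf.hasFPowerSeriesAt).eq_formalMultilinearSeries
    (hg.comp hf).hasFPowerSeriesAt
  have h2 := congrArg (fun p : FormalMultilinearSeries ℝ ℝ ℝ => p n fun _ => 1) h1
  simp only [FormalMultilinearSeries.comp, sum_apply,
    FormalMultilinearSeries.compAlongComposition_apply, FormalMultilinearSeries.applyComposition,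
    FormalMultilinearSeries.apply_eq_prod_smul_coeff, FormalMultilinearSeries.coeff_ofScalars,
    Function.comp_def, Finset.prod_const_one, smul_eq_mul, one_mul] at h2
  rw [eq_div_iff (by positivity)] at h2
  rw [mul_comm, Function.comp_def, ← h2]
  simp only [mul_comm]

/-- The polynomial function with Taylor coefficients `b` up to the order `n`. -/
def taylorPoly (b : ℕ → ℝ) (n : ℕ) (t : ℝ) : ℝ := ∑ j ∈ Finset.range (n + 1), b j * t ^ j

lemma contDiff_taylorPoly (b : ℕ → ℝ) (n : ℕ) : ContDiff ℝ ω (taylorPoly b n) := by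
  unfold taylorPoly
  fun_prop

lemma iteratedDeriv_taylorPoly (b : ℕ → ℝ) {n k : ℕ} (hk : k ≤ n) :
    iteratedDeriv k (taylorPoly b n) 0 = b k * k ! := by
  unfold taylorPoly
  rw [iteratedDeriv_fun_sum fun i _ => by fun_prop]
  simp only [iteratedDeriv_const_mul_field, iteratedDeriv_fun_pow_zero]
  rw [Finset.sum_eq_single k]
  · simp
  · intro j _ hj
    simp [hj.symm]
  · intro h
    exact absurd (Finset.mem_range.2 (by omega)) h

/-- Ordered set partitions weighted by the factorial of the number of blocks are counted by
compositions. -/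
theorem sum_orderedFinpartition_eq_sum_composition (a : ℕ → ℝ) (n : ℕ) :
    ∑ c : OrderedFinpartition n, (c.length ! : ℝ) * ∏ i, a (c.partSize i) =
      n ! * ∑ c : Composition n, ∏ i, a (c.blocksFun i) / (c.blocksFun i)! := by
  -- The identity follows by computing `(g ∘ f)^(n)(0)` with both Faà di Bruno formulas. The
  -- truncated geometric series `g` has `g^(k)(0) = k!`, producing the weights; `f` vanishes at `0`
  -- and has `f^(j)(0) = a j` for `j ≥ 1`. Orders above `n` never occur.
  let g := taylorPoly (fun _ => 1) n
  let f := taylorPoly (fun j => if j = 0 then 0 else a j / j !) n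
  have hf0 : f 0 = 0 := by
    simp [f, taylorPoly, Finset.sum_range_succ']
  have hg (k : ℕ) (hk : k ≤ n) : iteratedDeriv k g 0 = k ! := by
    simp [g, iteratedDeriv_taylorPoly _ hk]
  have hf (k : ℕ) (hk : k ≤ n) (hk0 : 0 < k) : iteratedDeriv k f 0 = a k := by
    rw [iteratedDeriv_taylorPoly _ hk, if_neg hk0.ne']
    field_simp
  have hgc : ContDiff ℝ ω g := contDiff_taylorPoly _ _
  have hfc : ContDiff ℝ ω f := contDiff_taylorPoly _ _
  have h1 := iteratedDeriv_comp_eq_sum_composition (x := 0) (hgc.contDiffAt (x := f 0)).analyticAt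
    hfc.contDiffAt.analyticAt n
  rw [iteratedDeriv_comp_eq_sum_orderedFinpartition hgc.contDiffAt hfc.contDiffAt
    (i := n) le_top] at h1
  rw [hf0] at h1
  calc
    _ = _ := Finset.sum_congr rfl fun c _ => ?_
    _ = _ := h1
    _ = _ := congrArg ((n ! : ℝ) * ·) (Finset.sum_congr rfl fun c _ => ?_)
  · rw [hg _ c.length_le]
    congr 1
    exact Finset.prod_congr rfl fun i _ => (hf _ (c.partSize_le i) (c.partSize_pos i)).symm
  · rw [hg _ c.length_le, div_self (by positivity), one_mul]
    exact Finset.prod_congr rfl fun i _ => by rw [hf _ (c.blocksFun_le i) (c.one_le_blocksFun i)]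

end Combinatorics

/-! ### The operator norm of multilinear forms. -/

section TensorNorm

variable {V : Type*} [NormedAddCommGroup V] [NormedSpace ℝ V] [FiniteDimensional ℝ V] {k : ℕ}

lemma continuous_multilinearMap (m : MultilinearMap ℝ (fun _ : Fin k => V) ℝ) : Continuous m := by
  let b := Module.finBasis ℝ V
  have h : ⇑m = fun u => ∑ J : Fin k → Fin (Module.finrank ℝ V),
      (∏ l, b.coord (J l) (u l)) * m (fun l => b (J l)) := by
    ext u
    rw [← multilinearMap_sum_smul m (fun l i => b.coord i (u l)) b]
    simp only [Module.Basis.coord_apply, b.sum_repr]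
  rw [h]
  have hb (i) : Continuous (b.coord i) := (b.coord i).continuous_of_finiteDimensional
  fun_prop

/-- Finite dimension makes `m` continuous, so its values on unit vectors are bounded and the `sSup`
is a true supremum. -/
lemma le_tensorNorm (m : MultilinearMap ℝ (fun _ : Fin k => V) ℝ) {u : Fin k → V}
    (hu : ∀ i, ‖u i‖ = 1) : m u ≤ tensorNorm m := by
  refine le_csSup ⟨‖ContinuousMultilinearMap.mk m (continuous_multilinearMap m)‖, ?_⟩
    ⟨u, hu, rfl⟩
  rintro r ⟨w, hw, rfl⟩
  have h := (ContinuousMultilinearMap.mk m (continuous_multilinearMap m)).le_opNorm w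
  simp only [hw, Finset.prod_const_one, mul_one] at h
  exact (le_abs_self _).trans h

/-- The supremum is taken without absolute values; flipping the sign of one argument bounds `-m` as
well, which needs a slot to flip. For `k = 0` the norm is the form itself and may be negative. -/
lemma abs_le_tensorNorm_mul_prod (hk : 0 < k) (m : MultilinearMap ℝ (fun _ : Fin k => V) ℝ)
    (u : Fin k → V) : |m u| ≤ tensorNorm m * ∏ i, ‖u i‖ := by
  by_cases hu : ∃ i, u i = 0
  · obtain ⟨i, hi⟩ := hu
    rw [m.map_coord_zero i hi, Finset.prod_eq_zero (Finset.mem_univ i) (by simp [hi])]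
    simp
  push Not at hu
  let w (i : Fin k) : V := ‖u i‖⁻¹ • u i
  have hw (i) : ‖w i‖ = 1 := by
    simp [w, norm_smul, hu i]
  have hmu : m u = (∏ i, ‖u i‖) * m w := by
    rw [← smul_eq_mul, ← m.map_smul_univ]
    congr 1
    ext i
    simp [w, smul_smul, hu i]
  have hneg : -m w ≤ tensorNorm m := by
    let i : Fin k := ⟨0, hk⟩
    have h := m.map_update_neg w i (w i)
    rw [Function.update_eq_self] at h
    rw [← h]
    refine le_tensorNorm m fun j => ?_
    rcases eq_or_ne j i with rfl | hj
    · simp [hw]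
    · simp [hj, hw]
  rw [hmu, abs_mul, abs_of_nonneg (by positivity), mul_comm]
  gcongr
  exact abs_le'.2 ⟨le_tensorNorm m hw, hneg⟩

end TensorNorm

/-! ### The covariant Faà di Bruno formula. -/

section CovariantFaaDiBruno

variable {E : Type*} [NormedAddCommGroup E] [NormedSpace ℝ E] [FiniteDimensional ℝ E]
  {M : Type*} [TopologicalSpace M] [ChartedSpace E M] [IsManifold 𝓘(ℝ, E) ∞ M]
  [RiemannianBundle (fun x : M => TangentSpace 𝓘(ℝ, E) x)]
  [IsContMDiffRiemannianBundle 𝓘(ℝ, E) ∞ E (fun x : M => TangentSpace 𝓘(ℝ, E) x)]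

variable {f : M → ℝ} {γ : ℝ → M} {t : ℝ}

lemma isTensorField_iteratedCovDeriv (k : ℕ) {n : ℕ}
    (hf : ContMDiff 𝓘(ℝ, E) 𝓘(ℝ, ℝ) ((n + k : ℕ) : WithTop ℕ∞) f) :
    IsTensorField n (iteratedCovDeriv E f k) := by
  induction k generalizing n with
  | zero =>
    exact ⟨fun x => ⟨MultilinearMap.constOfIsEmpty ℝ _ (f x), fun _ => rfl⟩, fun _ => hf _⟩
  | succ k ih => exact (ih (n := n + 1) (by rwa [add_right_comm, add_assoc])).tensorCovDeriv

lemma mvfderiv_unitField (g : ℝ → ℝ) (t : ℝ) :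
    mvfderiv 𝓘(ℝ, ℝ) g t (unitField t) = deriv g t := by
  rw [mvfderiv, mfderiv_eq_fderiv]
  rfl

variable (E) in
/-- The `j`-th covariant derivative of a curve: `γ'` for `j = 1`, and `D_t^{j-1} γ'` in general. -/
def curveDeriv (γ : ℝ → M) (j : ℕ) : Π t : ℝ, TangentSpace 𝓘(ℝ, E) (γ t) :=
  (covDerivAlong E γ)^[j - 1] (velocity E γ)

/-- Positivity matters: by truncated subtraction, indices `0` and `1` both give `γ'`. -/
lemma curveDeriv_succ {j : ℕ} (hj : 0 < j) :
    curveDeriv E γ (j + 1) = covDerivAlong E γ (curveDeriv E γ j) := by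
  obtain ⟨j, rfl⟩ := Nat.exists_eq_succ_of_ne_zero hj.ne'
  exact Function.iterate_succ_apply' _ _ _

lemma smoothAlongAt_curveDeriv (hγ : ContMDiff 𝓘(ℝ, ℝ) 𝓘(ℝ, E) ∞ γ) (j : ℕ) :
    SmoothAlongAt ℝ γ (curveDeriv E γ j) t := by
  unfold curveDeriv
  induction j - 1 generalizing t with
  | zero => exact smoothAlongAt_velocity hγ
  | succ j ih =>
    rw [Function.iterate_succ_apply']
    exact smoothAlongAt_covDerivAlong hγ ih

/-- The covariant **Faà di Bruno formula** along a curve. -/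
theorem iteratedDeriv_comp_curve {m : ℕ}
    (hf : ContMDiff 𝓘(ℝ, E) 𝓘(ℝ, ℝ) (m : WithTop ℕ∞) f)
    (hγ : ContMDiff 𝓘(ℝ, ℝ) 𝓘(ℝ, E) ∞ γ) {n : ℕ} (hn : n ≤ m) (t : ℝ) :
    iteratedDeriv n (f ∘ γ) t = ∑ c : OrderedFinpartition n,
      iteratedCovDeriv E f c.length (γ t) fun i => curveDeriv E γ (c.partSize i) t := by
  induction n generalizing t with
  | zero =>
    rw [Fintype.sum_unique]
    rfl
  | succ n ih =>
    have hγt : MDifferentiableAt 𝓘(ℝ, ℝ) 𝓘(ℝ, E) γ t := (hγ t).mdifferentiableAt (by simp)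
    -- As `c.length ≤ n < m`, the field `∇^{c.length} f` is still at least `C^1`, which the form `…
    -- - 1 + 1` of its class records.
    have hterm (c : OrderedFinpartition n) :=
      (isTensorField_iteratedCovDeriv (E := E) (n := m - c.length - 1 + 1) c.length (f := f) (by
        have := c.length_le
        rwa [show m - c.length - 1 + 1 + c.length = m by omega])).mvfderiv_along hγt
        (W := fun i => curveDeriv E γ (c.partSize i))
        (fun i => (smoothAlongAt_curveDeriv hγ _).mdiffAlongAt) (unitField t)
    rw [iteratedDeriv_succ, funext (ih (Nat.le_of_succ_le hn)), ← mvfderiv_unitField,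
      (mvfderiv_finset_sum Finset.univ
        (f := fun (c : OrderedFinpartition n) t => iteratedCovDeriv E f c.length (γ t)
          fun i => curveDeriv E γ (c.partSize i) t) fun c _ => (hterm c).1).2, sum_apply,
      ← (OrderedFinpartition.extendEquiv n).sum_comp, Fintype.sum_sigma]
    refine Finset.sum_congr rfl fun c _ => ?_
    rw [(hterm c).2, Fintype.sum_option]
    -- `none` adds a singleton as first block, matching `γ'` in the new first slot of `∇^{k+1} f`;
    -- `some l` enlarges block `l`, matching `D_t` on argument `l`. The order of slots must agree,
    -- since no symmetry of `∇^k f` is used.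
    refine congrArg₂ (· + ·) ?_ (Finset.sum_congr rfl fun l _ => ?_)
    · change iteratedCovDeriv E f (c.length + 1) (γ t) _ =
        iteratedCovDeriv E f (c.length + 1) (γ t)
          fun i => curveDeriv E γ ((Fin.cons 1 c.partSize : Fin (c.length + 1) → ℕ) i) t
      congr 1
      ext i
      refine Fin.cases ?_ (fun i => ?_) i
      · rfl
      · simp
    · change _ = iteratedCovDeriv E f c.length (γ t)
          fun i => curveDeriv E γ (Function.update c.partSize l (c.partSize l + 1) i) t
      congr 1
      ext i
      rcases eq_or_ne i l with rfl | hi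
      · rw [Function.update_self, Function.update_self, curveDeriv_succ (c.partSize_pos i),
          covDerivAlong_eq_covAlong hγ.continuous.continuousAt]
      · simp [hi]

end CovariantFaaDiBruno

/-! ### The pullback to a tangent space and its restriction to lines. -/

section Pullback

variable {E : Type*} [NormedAddCommGroup E] [NormedSpace ℝ E] [FiniteDimensional ℝ E]
  {M : Type*} [TopologicalSpace M] [ChartedSpace E M] [IsManifold 𝓘(ℝ, E) ∞ M]
  [RiemannianBundle (fun x : M => TangentSpace 𝓘(ℝ, E) x)]
  [IsContMDiffRiemannianBundle 𝓘(ℝ, E) ∞ E (fun x : M => TangentSpace 𝓘(ℝ, E) x)]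

/-- In the trivialization at `x` the base point is constant and the fibre coordinate is a continuous
linear map. -/
lemma contMDiff_fiberInclusion (x : M) :
    ContMDiff 𝓘(ℝ, TangentSpace 𝓘(ℝ, E) x) 𝓘(ℝ, E).tangent ∞
      (fun u : TangentSpace 𝓘(ℝ, E) x => (⟨x, u⟩ : TangentBundle 𝓘(ℝ, E) M)) := by
  intro u
  rw [Bundle.contMDiffAt_totalSpace]
  refine ⟨contMDiffAt_const, ?_⟩
  simp only [trivializationAt_eq_coord (mem_baseSet_self E x)]
  exact (coord E x x).contMDiff.contMDiffAt

variable {R : TangentBundle 𝓘(ℝ, E) M → M} {f : M → ℝ} {x : M}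

lemma contDiff_pullback (hR : ContMDiff 𝓘(ℝ, E).tangent 𝓘(ℝ, E) ∞ R) {n : ℕ}
    (hf : ContMDiff 𝓘(ℝ, E) 𝓘(ℝ, ℝ) (n : WithTop ℕ∞) f) :
    ContDiff ℝ n (fun u : TangentSpace 𝓘(ℝ, E) x => f (R ⟨x, u⟩)) :=
  (hf.comp ((hR.comp (contMDiff_fiberInclusion x)).of_le (by exact_mod_cast le_top))).contDiff

lemma contMDiff_retractionCurve (hR : ContMDiff 𝓘(ℝ, E).tangent 𝓘(ℝ, E) ∞ R)
    (v w : TangentSpace 𝓘(ℝ, E) x) :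
    ContMDiff 𝓘(ℝ, ℝ) 𝓘(ℝ, E) ∞ (fun t : ℝ => R ⟨x, v + t • w⟩) := by
  have h : ContDiff ℝ ∞ (fun t : ℝ => v + t • w) := by fun_prop
  exact (hR.comp (contMDiff_fiberInclusion x)).comp h.contMDiff

lemma iteratedFDeriv_eq_iteratedDeriv_line {V : Type*} [NormedAddCommGroup V] [NormedSpace ℝ V]
    {n : ℕ} {h : V → ℝ} (hh : ContDiff ℝ n h) (v w : V) :
    iteratedFDeriv ℝ n h v (fun _ => w) = iteratedDeriv n (fun t : ℝ => h (v + t • w)) 0 := by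
  have hh' : ContDiff ℝ n (fun u => h (v + u)) := hh.comp (by fun_prop)
  have h1 := (ContinuousLinearMap.toSpanSingleton ℝ w).iteratedFDeriv_comp_right hh' 0 le_rfl
  rw [iteratedDeriv_eq_iteratedFDeriv]
  change _ = iteratedFDeriv ℝ n ((fun u => h (v + u)) ∘ ContinuousLinearMap.toSpanSingleton ℝ w) 0 _
  rw [h1, iteratedFDeriv_comp_add_left]
  simp

lemma abs_iteratedCovDeriv_le {k : ℕ} (hk : 0 < k)
    (hf : ContMDiff 𝓘(ℝ, E) 𝓘(ℝ, ℝ) (k : WithTop ℕ∞) f) (y : M)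
    (u : Fin k → TangentSpace 𝓘(ℝ, E) y) :
    |iteratedCovDeriv E f k y u| ≤ tensorNorm (iteratedCovDeriv E f k y) * ∏ i, ‖u i‖ := by
  have : FiniteDimensional ℝ (TangentSpace 𝓘(ℝ, E) y) := inferInstanceAs (FiniteDimensional ℝ E)
  obtain ⟨m, hm⟩ := (isTensorField_iteratedCovDeriv (E := E) (n := 0) k
    (by rwa [zero_add])).multilinear y
  rw [← funext hm]
  exact abs_le_tensorNorm_mul_prod hk m u

end Pullback

end RiemannianPullback

end

/-! ### The derivative estimate. -/

theorem mainTheorem4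
    {E : Type*} [NormedAddCommGroup E] [NormedSpace ℝ E] [FiniteDimensional ℝ E]
    {M : Type*} [TopologicalSpace M] [T2Space M] [ChartedSpace E M] [IsManifold 𝓘(ℝ, E) ∞ M]
    [RiemannianBundle (fun x : M => TangentSpace 𝓘(ℝ, E) x)]
    [IsContMDiffRiemannianBundle 𝓘(ℝ, E) ∞ E (fun x : M => TangentSpace 𝓘(ℝ, E) x)]
    (R : TangentBundle 𝓘(ℝ, E) M → M) (hR : IsRetraction R)
    (p : ℕ) (f : M → ℝ) (hf : ContMDiff 𝓘(ℝ, E) 𝓘(ℝ, ℝ) ((p + 1 : ℕ) : WithTop ℕ∞) f)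
    (x : M) (v w : TangentSpace 𝓘(ℝ, E) x)
    (γ : ℝ → M) (hγ : ∀ t : ℝ, γ t = R ⟨x, v + t • w⟩) :
    |iteratedFDeriv ℝ (p + 1) (fun u : TangentSpace 𝓘(ℝ, E) x => f (R ⟨x, u⟩)) v (fun _ => w)|
      ≤ ((p + 1)! : ℝ)
        * (Finset.Icc 1 (p + 1)).sup' (Finset.nonempty_Icc.mpr (Nat.le_add_left 1 p))
            (fun k => tensorNorm (iteratedCovDeriv E f k (R ⟨x, v⟩)) / (k ! : ℝ))
        * ∑ l : Composition (p + 1), ∏ i : Fin l.length,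
            ‖(covDerivAlong E γ)^[l.blocksFun i - 1] (velocity E γ) 0‖ / ((l.blocksFun i)! : ℝ) := by
  obtain rfl : γ = fun t => R ⟨x, v + t • w⟩ := funext hγ
  set γ : ℝ → M := fun t => R ⟨x, v + t • w⟩
  have hγs : ContMDiff 𝓘(ℝ, ℝ) 𝓘(ℝ, E) ∞ γ := contMDiff_retractionCurve hR.contMDiff v w
  have hγ0 : γ 0 = R ⟨x, v⟩ := by simp [γ]
  rw [iteratedFDeriv_eq_iteratedDeriv_line (contDiff_pullback hR.contMDiff hf), ← hγ0]
  change |iteratedDeriv (p + 1) (f ∘ γ) 0| ≤ _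
  rw [iteratedDeriv_comp_curve hf hγs le_rfl]
  set K := (Finset.Icc 1 (p + 1)).sup' (Finset.nonempty_Icc.mpr (Nat.le_add_left 1 p))
    (fun k => tensorNorm (iteratedCovDeriv E f k (γ 0)) / (k ! : ℝ))
  -- The factor `c.length !` compensates the division inside the maximum `K`. A partition of `p + 1
  -- > 0` points has between `1` and `p + 1` blocks, so its order lies in the range of `K`.
  have hbound (c : OrderedFinpartition (p + 1)) :
      |iteratedCovDeriv E f c.length (γ 0) fun i => curveDeriv E γ (c.partSize i) 0| ≤
        K * ((c.length ! : ℝ) * ∏ i, ‖curveDeriv E γ (c.partSize i) 0‖) := by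
    have hpos := c.length_pos p.succ_pos
    refine (abs_iteratedCovDeriv_le hpos (hf.of_le (by exact_mod_cast c.length_le)) _ _).trans ?_
    rw [← mul_assoc]
    gcongr
    rw [← div_le_iff₀ (by positivity)]
    exact Finset.le_sup' (fun k => tensorNorm (iteratedCovDeriv E f k (γ 0)) / (k ! : ℝ))
      (Finset.mem_Icc.2 ⟨hpos, c.length_le⟩)
  refine (Finset.abs_sum_le_sum_abs _ _).trans ((Finset.sum_le_sum fun c _ => hbound c).trans ?_)
  rw [← Finset.mul_sum, sum_orderedFinpartition_eq_sum_composition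
    (fun j => ‖curveDeriv E γ j 0‖), mul_left_comm, ← mul_assoc]
  exact le_rfl
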